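/- **Setting.** Fix a many-sorted signature: a set of sorts and, for each sort $s$, a set $F_s$ of function symbols (the *generators* of $s$) $\mathsf f : s_1\times\dots\times s_n\to s$; the only predicates are equality and $\operatorname{fin}_s$ for every sort $s$. The structure $\mathcal T$ of trees interprets $s$ as the set of finite and infinite ordered trees of sort $s$ (the root is labelled by some $\mathsf f : s_1\times\dots\times s_n\to s$ in $F_s$ and its children, in order, are the roots of trees of sorts $s_1,\dots,s_n$), $\mathsf f$ as the operation of putting a root labelled $\mathsf f$ above given trees, and $\operatorname{fin}_s$ as the set of finite trees of sort $s$. Satisfiability and equivalence refer to $\mathcal T$. Let $S_{FF}$, respectively $S_{FI}$, be the set of sorts with only finitely many (possibly no) finite, respectively infinite, trees. Assume that every sort has at least two generators. If there are infinitely generated sorts, assume moreover that every sort $s$ with infinitely many generators which has both finite and infinite trees satisfies: if $s\notin S_{FF}$, then infinitely many generators of $s$ are roots of finite trees of sort $s$; and if $s\notin S_{FI}$, then infinitely many generators of $s$ are roots of infinite trees of sort $s$. (This is void if all sorts are finitely generated.) **Basic formulae.** A *basic formula* is a finite conjunction $\bigwedge_i v_i=t_i\land\bigwedge_j\operatorname{fin}(u_j)$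 with variables $v_i,u_j$, where each $t_i$ is a variable or of the form $\mathsf f(\bar z)$ with variables $\bar z$. It is *solved* for a total order on the variables if all the variables $\bar u,\bar v$ are distinct, $x>y$ for each equation $x=y$ between variables, and the sort of each $u_j$ has both finite and infinite trees. A variable $y$ is *reachable* from $x$ if there are $n\ge 0$ and conjuncts $x_0=t_0,\dots,x_{n-1}=t_{n-1}$ with $x_0=x$, $x_n=y$ and $x_{i+1}$ occurring in $t_i$; *properly reachable* if $n>0$ is possible. **Solved normal formulae.** Consider $\psi=\lnot(\exists\bar x.\,\alpha\land\bigwedge_{i=1}^{m}\lnot(\exists\bar y_i.\,\beta_i))$, $m\ge0$, with basic formulae $\alpha,\beta_i$ and with bound variables that are pairwise distinct and different from the free ones. Let $\beta_i^*$ be $\beta_i$ without the conjuncts that occur in $\alpha$. A variable $v$ of sort $s$ that is free in $\psi$ or among $\bar x$ is *instantiable* if 1. $F_s$ is finite and, for some $i$, $\beta_i^*$ contains an equation $v=\mathsf f(\bar w)$ and $v$ is not properly reachable from $v$ in $\beta_i$; or 2. $s\in S_{FF}\cap S_{FI}$, $v$ occurs in some $\beta_i^*$, and $\alpha$ contains no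 equation $v=t$; or 3. $s\in S_{FF}$, $\alpha$ contains $\operatorname{fin}(v)$, and $v$ occurs in some $\beta_i^*$; or 4. $s\in S_{FI}$ and some $\beta_i^*$ contains no equations but contains $\operatorname{fin}(v)$. The formula $\psi$ is *solved* if (1) $\alpha$ and all $\beta_i$ are solved for one total order on the variables in which $u<v$ whenever $u$ is free where $v$ is bound (free variables of $\psi$ are smaller than $\bar x$, and both are smaller than each $\bar y_i$); (2) all equations of $\alpha$ occur in every $\beta_i$; (3) each $\beta_i$ has a conjunct that does not occur in $\alpha$; (4) there are no instantiable variables; (5) each variable of $\bar x$, respectively $\bar y_i$, is reachable in $\alpha$, respectively $\beta_i$, from a free variable of $\exists\bar x.\,\alpha$, respectively $\exists\bar y_i.\,\beta_i$. A formula $\phi$ is *fully simplified* if $\lnot\phi$ is a solved normal formula of this form. **Theorem.** Let $\phi$ be a fully simplified formula. If $\phi$ has no free variables, then $\phi$ is the formula $\mathrm{true}$ (the empty conjunction), and in particular equivalent to $\mathrm{true}$. If $\phi$ has a free variable, then both $\phi$ and $\lnot\phi$ are satisfiable in the structure of trees. -/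

import Mathlib

universe u v w

namespace TreeTheory

/-- A many-sorted signature: `Gen s` is the set of function symbols (generators) whose result sort
is `s`; a generator `f` takes `arity f` arguments, the `i`-th one of sort `dom f i`.
The only predicate symbols are the finiteness predicates, one for each sort; they are built into
the syntax of formulas. -/
structure Signature where
  Srt : Type u
  Gen : Srt → Type v
  arity : {s : Srt} → Gen s → ℕ
  dom : {s : Srt} → (f : Gen s) → Fin (arity f) → Srt

/-! ### Trees -/

/-- A (possibly infinite) ordered tree of sort `s`, given by its labelling. A node is the list of
child indices on the way from the root to it, and `label p = none` means that there is no node at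
position `p`. The root is labelled by a generator of `s`, and a node labelled by
`g : s₁ × ⋯ × sₙ → r` has exactly `n` children, whose labels are generators of `s₁, …, sₙ`. -/
@[ext]
structure Tree (σ : Signature.{u, v}) (s : σ.Srt) where
  label : List ℕ → Option (Σ r : σ.Srt, σ.Gen r)
  root : ∃ f : σ.Gen s, label [] = some ⟨s, f⟩
  child : ∀ (p : List ℕ) (r : σ.Srt) (g : σ.Gen r), label p = some ⟨r, g⟩ →
    ∀ i : Fin (σ.arity g), ∃ h : σ.Gen (σ.dom g i), label (p ++ [i.val]) = some ⟨σ.dom g i, h⟩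
  no_child : ∀ (p : List ℕ) (r : σ.Srt) (g : σ.Gen r), label p = some ⟨r, g⟩ →
    ∀ n : ℕ, σ.arity g ≤ n → label (p ++ [n]) = none
  closed : ∀ (p : List ℕ) (n : ℕ), label p = none → label (p ++ [n]) = none

namespace Tree

variable {σ : Signature.{u, v}}

/-- The positions of the nodes of a tree. -/
def nodes {s : σ.Srt} (t : Tree σ s) : Set (List ℕ) := {p | t.label p ≠ none}

/-- A tree is finite if it has finitely many nodes. -/
def IsFinite {s : σ.Srt} (t : Tree σ s) : Prop := t.nodes.Finite

/-- The labelling of the tree with root `f` and immediate subtrees `ts`. -/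
def nodeLabel {s : σ.Srt} (f : σ.Gen s) (ts : ∀ i, Tree σ (σ.dom f i)) :
    List ℕ → Option (Σ r : σ.Srt, σ.Gen r)
  | [] => some ⟨s, f⟩
  | n :: p => if h : n < σ.arity f then (ts ⟨n, h⟩).label p else none

/-- The interpretation of the function symbol `f` in the structure of trees: the tree with root
labelled `f` and immediate subtrees `ts`. -/
def node {s : σ.Srt} (f : σ.Gen s) (ts : ∀ i, Tree σ (σ.dom f i)) : Tree σ s where
  label := nodeLabel f ts
  root := ⟨f, rfl⟩
  child := by
    intro p r g hp i
    cases p with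
    | nil =>
      simp only [nodeLabel, Option.some.injEq] at hp
      cases hp
      obtain ⟨h, hh⟩ := (ts i).root
      exact ⟨h, by simp [nodeLabel, hh]⟩
    | cons n p =>
      by_cases hn : n < σ.arity f
      · simp only [nodeLabel, hn, dif_pos] at hp
        obtain ⟨h, hh⟩ := (ts ⟨n, hn⟩).child p r g hp i
        exact ⟨h, by simp [nodeLabel, hn, hh]⟩
      · simp [nodeLabel, hn] at hp
  no_child := by
    intro p r g hp m hm
    cases p with
    | nil =>
      simp only [nodeLabel, Option.some.injEq] at hp
      cases hp
      simp [nodeLabel, Nat.not_lt.mpr hm]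
    | cons n p =>
      by_cases hn : n < σ.arity f
      · simp only [nodeLabel, hn, dif_pos] at hp
        simpa [nodeLabel, hn] using (ts ⟨n, hn⟩).no_child p r g hp m hm
      · simp [nodeLabel, hn]
  closed := by
    intro p m hp
    cases p with
    | nil => simp [nodeLabel] at hp
    | cons n p =>
      by_cases hn : n < σ.arity f
      · simp only [nodeLabel, hn, dif_pos] at hp
        simpa [nodeLabel, hn] using (ts ⟨n, hn⟩).closed p m hp
      · simp [nodeLabel, hn]

end Tree

namespace Signature

variable (σ : Signature.{u, v})

/-- The set of finite trees of sort `s`. -/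
def finTrees (s : σ.Srt) : Set (Tree σ s) := {t | t.IsFinite}

/-- The set of infinite trees of sort `s`. -/
def infTrees (s : σ.Srt) : Set (Tree σ s) := {t | ¬ t.IsFinite}

/-- The sorts with finitely many (possibly no) finite trees. -/
def SFF : Set σ.Srt := {s | (σ.finTrees s).Finite}

/-- The sorts with finitely many (possibly no) infinite trees. -/
def SFI : Set σ.Srt := {s | (σ.infTrees s).Finite}

/-- The generators labelling the root of some tree in `T`. -/
def rootGens {s : σ.Srt} (T : Set (Tree σ s)) : Set (σ.Gen s) :=
  {f | ∃ t ∈ T, t.label [] = some ⟨s, f⟩}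

/-- A condition on sorts that is void for finitely generated sorts, and also for sorts all of
whose trees are finite or all of whose trees are infinite. An infinitely generated sort that has
both finite and infinite trees must not have infinitely many finite trees that all start with one
of finitely many generators, and likewise for its infinite trees. -/
def RootDiverse (s : σ.Srt) : Prop :=
  Infinite (σ.Gen s) → (σ.finTrees s).Nonempty → (σ.infTrees s).Nonempty →
    (s ∉ σ.SFF → (σ.rootGens (σ.finTrees s)).Infinite) ∧
    (s ∉ σ.SFI → (σ.rootGens (σ.infTrees s)).Infinite)

end Signature

/-! ### First-order formulas over trees

`V s` is the set of variables of sort `s`. -/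

/-- A variable together with its sort. -/
abbrev Var (σ : Signature.{u, v}) (V : σ.Srt → Type w) := Σ s : σ.Srt, V s

/-- A valuation in the structure of trees. -/
abbrev Valuation (σ : Signature.{u, v}) (V : σ.Srt → Type w) := ∀ s : σ.Srt, V s → Tree σ s

inductive Term (σ : Signature.{u, v}) (V : σ.Srt → Type w) : σ.Srt → Type (max u v w)
  | var {s : σ.Srt} (x : V s) : Term σ V s
  | app {s : σ.Srt} (f : σ.Gen s) (args : ∀ i, Term σ V (σ.dom f i)) : Term σ V s

inductive Formula (σ : Signature.{u, v}) (V : σ.Srt → Type w) : Type (max u v w)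
  | verum : Formula σ V
  | eq {s : σ.Srt} (t t' : Term σ V s) : Formula σ V
  | fin {s : σ.Srt} (t : Term σ V s) : Formula σ V
  | neg (φ : Formula σ V) : Formula σ V
  | and (φ ψ : Formula σ V) : Formula σ V
  | ex (x : Var σ V) (φ : Formula σ V) : Formula σ V

variable {σ : Signature.{u, v}} {V : σ.Srt → Type w}

namespace Term

def eval (ρ : Valuation σ V) : {s : σ.Srt} → Term σ V s → Tree σ s
  | _, var x => ρ _ x
  | _, app f args => Tree.node f (fun i => (args i).eval ρ)

def vars : {s : σ.Srt} → Term σ V s → Set (Var σ V)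
  | s, var x => {⟨s, x⟩}
  | _, app _ args => ⋃ i, (args i).vars

end Term

namespace Formula

/-- Truth in the structure of trees under a valuation. -/
def Holds : Valuation σ V → Formula σ V → Prop
  | _, verum => True
  | ρ, eq t t' => t.eval ρ = t'.eval ρ
  | ρ, fin t => (t.eval ρ).IsFinite
  | ρ, neg φ => ¬ Holds ρ φ
  | ρ, and φ ψ => Holds ρ φ ∧ Holds ρ ψ
  | ρ, ex x φ => ∃ ρ' : Valuation σ V,
      (∀ (s : σ.Srt) (y : V s), (⟨s, y⟩ : Var σ V) ≠ x → ρ' s y = ρ s y) ∧ Holds ρ' φ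

def freeVars : Formula σ V → Set (Var σ V)
  | verum => ∅
  | eq t t' => t.vars ∪ t'.vars
  | fin t => t.vars
  | neg φ => φ.freeVars
  | and φ ψ => φ.freeVars ∪ ψ.freeVars
  | ex x φ => φ.freeVars \ {x}

/-- Satisfiability in the structure of trees. -/
def Satisfiable (φ : Formula σ V) : Prop := ∃ ρ : Valuation σ V, φ.Holds ρ

/-- Equivalence in the structure of trees. -/
def Equivalent (φ ψ : Formula σ V) : Prop := ∀ ρ : Valuation σ V, φ.Holds ρ ↔ ψ.Holds ρ

/-- The conjunction of a list of formulas; the empty conjunction is `verum`. -/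
def conj (l : List (Formula σ V)) : Formula σ V := l.foldr and verum

/-- Existential quantification over a list of variables. -/
def exs (xs : List (Var σ V)) (φ : Formula σ V) : Formula σ V := xs.foldr ex φ

end Formula

/-! ### Basic formulas -/

/-- A flat term: a variable, or a function symbol applied to variables. -/
inductive FlatTerm (σ : Signature.{u, v}) (V : σ.Srt → Type w) (s : σ.Srt) : Type (max u v w)
  | var (x : V s) : FlatTerm σ V s
  | app (f : σ.Gen s) (z : ∀ i, V (σ.dom f i)) : FlatTerm σ V s

def FlatTerm.toTerm {s : σ.Srt} : FlatTerm σ V s → Term σ V s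
  | .var x => .var x
  | .app f z => .app f (fun i => .var (z i))

/-- An equation `lhs = rhs` between a variable and a flat term. -/
structure Equation (σ : Signature.{u, v}) (V : σ.Srt → Type w) where
  sort : σ.Srt
  lhs : V sort
  rhs : FlatTerm σ V sort

namespace Equation

def lhsVar (e : Equation σ V) : Var σ V := ⟨e.sort, e.lhs⟩

def toFormula (e : Equation σ V) : Formula σ V := .eq (.var e.lhs) e.rhs.toTerm

end Equation

/-- The atomic formula stating that the tree `x` is finite. -/
def finAtom (x : Var σ V) : Formula σ V := .fin (.var x.2)

/-- A basic formula: a conjunction of equations and of constraints `fin u` for the listed `u`. -/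
structure BasicFormula (σ : Signature.{u, v}) (V : σ.Srt → Type w) where
  eqs : List (Equation σ V)
  fins : List (Var σ V)

namespace BasicFormula

/-- The conjuncts of a basic formula. -/
def atoms (α : BasicFormula σ V) : List (Formula σ V) :=
  α.eqs.map Equation.toFormula ++ α.fins.map finAtom

def toFormula (α : BasicFormula σ V) : Formula σ V := Formula.conj α.atoms

/-- `y` occurs on the right-hand side of an equation with left-hand side `x`. -/
def Step (α : BasicFormula σ V) (x y : Var σ V) : Prop :=
  ∃ e ∈ α.eqs, e.lhsVar = x ∧ y ∈ e.rhs.toTerm.vars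

/-- `y` is reachable from `x`. -/
def Reachable (α : BasicFormula σ V) : Var σ V → Var σ V → Prop := Relation.ReflTransGen α.Step

/-- `y` is properly reachable from `x`. -/
def ProperlyReachable (α : BasicFormula σ V) : Var σ V → Var σ V → Prop :=
  Relation.TransGen α.Step

/-- Solved basic formulas with respect to the (strict, total) variable ordering `lt`. -/
structure IsSolved (lt : Var σ V → Var σ V → Prop) (α : BasicFormula σ V) : Prop where
  distinct : (α.eqs.map Equation.lhsVar ++ α.fins).Nodup
  ordered : ∀ (s : σ.Srt) (x y : V s), ⟨s, x, .var y⟩ ∈ α.eqs → lt ⟨s, y⟩ ⟨s, x⟩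
  fin_sorts : ∀ x ∈ α.fins, (σ.finTrees x.1).Nonempty ∧ (σ.infTrees x.1).Nonempty

end BasicFormula

/-- An existentially quantified basic formula `∃ bound, basic`. -/
structure ExBasic (σ : Signature.{u, v}) (V : σ.Srt → Type w) where
  bound : List (Var σ V)
  basic : BasicFormula σ V

def ExBasic.toFormula (β : ExBasic σ V) : Formula σ V :=
  Formula.exs β.bound β.basic.toFormula

/-- All bound variables are reachable from the free variables of the formula. -/
def ExBasic.AllReachable (β : ExBasic σ V) : Prop :=
  ∀ x ∈ β.bound, ∃ z ∈ β.toFormula.freeVars, β.basic.Reachable z x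

/-! ### Normal formulas -/

/-- A normal formula `¬ (∃ x̄, α ∧ ⋀ᵢ ¬ (∃ ȳᵢ, βᵢ))` of depth at most two; `outer` holds `x̄` and
`α`, and `inner` lists the pairs of `ȳᵢ` and `βᵢ`. -/
structure NormalFormula (σ : Signature.{u, v}) (V : σ.Srt → Type w) where
  outer : ExBasic σ V
  inner : List (ExBasic σ V)

namespace NormalFormula

/-- The formula `∃ x̄, α ∧ ⋀ᵢ ¬ (∃ ȳᵢ, βᵢ)`. -/
def body (N : NormalFormula σ V) : Formula σ V :=
  Formula.exs N.outer.bound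
    (Formula.conj (N.outer.basic.atoms ++ N.inner.map (fun β => .neg β.toFormula)))

/-- The formula `¬ (∃ x̄, α ∧ ⋀ᵢ ¬ (∃ ȳᵢ, βᵢ))`. -/
def toFormula (N : NormalFormula σ V) : Formula σ V := .neg N.body

/-- The variable convention: the bound variables are pairwise distinct and different from the
free variables. -/
def VariableConvention (N : NormalFormula σ V) : Prop :=
  (N.outer.bound ++ N.inner.flatMap ExBasic.bound).Nodup ∧
  ∀ x ∈ N.outer.bound ++ N.inner.flatMap ExBasic.bound, x ∉ N.toFormula.freeVars

/-- `c` is a conjunct of `β*`, i.e. a conjunct of `β` that is not a conjunct of `α`. -/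
def StarAtom (N : NormalFormula σ V) (β : ExBasic σ V) (c : Formula σ V) : Prop :=
  c ∈ β.basic.atoms ∧ c ∉ N.outer.basic.atoms

/-- The variable `x` occurs in `β*`. -/
def OccursInStar (N : NormalFormula σ V) (β : ExBasic σ V) (x : Var σ V) : Prop :=
  ∃ c, N.StarAtom β c ∧ x ∈ c.freeVars

/-- Instantiable variables; the last four clauses are the four alternative reasons for a variable
to be instantiable. -/
def Instantiable (N : NormalFormula σ V) (x : Var σ V) : Prop :=
  (x ∈ N.toFormula.freeVars ∨ x ∈ N.outer.bound) ∧
  ((Finite (σ.Gen x.1) ∧ ∃ β ∈ N.inner,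
      (∃ (f : σ.Gen x.1) (z : ∀ i, V (σ.dom f i)),
        N.StarAtom β (Equation.toFormula ⟨x.1, x.2, .app f z⟩)) ∧
      ¬ β.basic.ProperlyReachable x x) ∨
   (x.1 ∈ σ.SFF ∩ σ.SFI ∧ (∃ β ∈ N.inner, N.OccursInStar β x) ∧
      ∀ e ∈ N.outer.basic.eqs, e.lhsVar ≠ x) ∨
   (x.1 ∈ σ.SFF ∧ x ∈ N.outer.basic.fins ∧ ∃ β ∈ N.inner, N.OccursInStar β x) ∨
   (x.1 ∈ σ.SFI ∧ ∃ β ∈ N.inner,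
      (∀ c, N.StarAtom β c → ∃ y, c = finAtom y) ∧ N.StarAtom β (finAtom x)))

/-- Solved normal formulas (of depth at most two). -/
structure IsSolved (N : NormalFormula σ V) : Prop where
  /-- `α` and all `βᵢ` are solved for a variable ordering in which a variable is smaller than
  every variable bound at a place where it is free. -/
  solved_basic : ∃ lt : Var σ V → Var σ V → Prop, IsStrictTotalOrder (Var σ V) lt ∧
    (∀ x ∈ N.toFormula.freeVars, ∀ y ∈ N.outer.bound, lt x y) ∧
    (∀ β ∈ N.inner, ∀ x, x ∈ N.toFormula.freeVars ∨ x ∈ N.outer.bound →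
      ∀ y ∈ β.bound, lt x y) ∧
    N.outer.basic.IsSolved lt ∧ ∀ β ∈ N.inner, β.basic.IsSolved lt
  eqs_included : ∀ β ∈ N.inner, ∀ e ∈ N.outer.basic.eqs, e ∈ β.basic.eqs
  new_conjunct : ∀ β ∈ N.inner, ∃ c, N.StarAtom β c
  no_instantiable : ∀ x, ¬ N.Instantiable x
  outer_reachable : N.outer.AllReachable
  inner_reachable : ∀ β ∈ N.inner, β.AllReachable

end NormalFormula

namespace Formula

/-- `χ` is a solved normal formula. -/
def IsSolvedNormal (χ : Formula σ V) : Prop :=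
  ∃ N : NormalFormula σ V, N.VariableConvention ∧ N.IsSolved ∧ χ = N.toFormula

/-- `φ` is fully simplified if its negation is a solved normal formula. -/
def FullySimplified (φ : Formula σ V) : Prop := IsSolvedNormal (.neg φ)

end Formula

end TreeTheory

/-! Call a variable a parameter of a solved system if it is not the left-hand side of an equation.
The system acts as a corecursive definition of the other variables: all parameter values extend to a
solution (`IsSolved.exists_satEqs`), and the value of a variable depends only on the parameters
reachable from it (`IsSolved.eq_of_satEqs`). Write the formula as `∃ x̄, α ∧ ⋀ᵢ ¬ (∃ ȳᵢ, βᵢ)`.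

To satisfy it, find for each `βᵢ` a parameter `x` of `α` that can refute it
(`IsSolved.exists_falsifying`). A new equation `x = f(z)` fixes the root of `x`; over finitely many
generators, non-instantiability moreover makes `x` properly reachable from itself, so its tree
recurs inside itself at a fixed nonempty position. A new equation `x = y` either leaves at most one
value for `x` or again forces such a recurrence. If neither kind is present, some new `fin x` is
refuted by an infinite tree. The bad values thus form a `Thin` set.

Non-instantiability also guarantees infinitely many candidate values for `x`, and finitely many thin
sets never cover them (`rich_finTrees`, `rich_infTrees`): finite trees do not recur inside
themselves, grafting yields enough infinite trees that do not, and infinitely generated sorts offer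
infinitely many roots. The parameters are then chosen one at a time. A later choice may disturb an
earlier one through `α`, but only for a thin set of values, which is what `Avoidable` records
(`IsSolved.exists_avoiding`).

To falsify it, break one conjunct of `α` by another root or an infinite tree; if `α` is empty, make
one `βᵢ` true. Without free variables, reachability rules out bound variables too, so no conjunct
remains. -/

namespace TreeTheory

namespace Tree

variable {σ : Signature.{u, v}}

/-! ### Construction of trees -/

section Unfold

variable {X : σ.Srt → Type*}
  (c : ∀ s, X s → Tree σ s ⊕ (Σ f : σ.Gen s, ∀ i, X (σ.dom f i)))

/-- The labelling of the tree unfolded from the state `x` of the coalgebra `c`, in which a state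
may also be given directly by a tree. -/
def unfoldLabel : List ℕ → ∀ s : σ.Srt, X s → Option (Σ r : σ.Srt, σ.Gen r)
  | [], s, x => match c s x with
    | .inl t => t.label []
    | .inr ⟨f, _⟩ => some ⟨s, f⟩
  | n :: p, s, x => match c s x with
    | .inl t => t.label (n :: p)
    | .inr ⟨f, z⟩ => if h : n < σ.arity f then unfoldLabel p _ (z ⟨n, h⟩) else none

variable {c}

theorem unfoldLabel_inl {s : σ.Srt} {x : X s} {t : Tree σ s} (h : c s x = .inl t) (p : List ℕ) :
    unfoldLabel c p s x = t.label p := by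
  cases p <;> simp [unfoldLabel, h]

theorem unfoldLabel_nil {s : σ.Srt} {x : X s} {f : σ.Gen s} {z : ∀ i, X (σ.dom f i)}
    (h : c s x = .inr ⟨f, z⟩) : unfoldLabel c [] s x = some ⟨s, f⟩ := by
  simp [unfoldLabel, h]

theorem unfoldLabel_cons {s : σ.Srt} {x : X s} {f : σ.Gen s} {z : ∀ i, X (σ.dom f i)}
    (h : c s x = .inr ⟨f, z⟩) (n : ℕ) (p : List ℕ) :
    unfoldLabel c (n :: p) s x =
      if hn : n < σ.arity f then unfoldLabel c p _ (z ⟨n, hn⟩) else none := by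
  simp [unfoldLabel, h]

theorem unfoldLabel_root (s : σ.Srt) (x : X s) :
    ∃ f : σ.Gen s, unfoldLabel c [] s x = some ⟨s, f⟩ := by
  rcases h : c s x with t | ⟨f, z⟩
  · simpa [unfoldLabel_inl h] using t.root
  · exact ⟨f, unfoldLabel_nil h⟩

variable (c)

/-- The tree unfolded from the state `x` of the coalgebra `c`. -/
def unfold {s : σ.Srt} (x : X s) : Tree σ s where
  label p := unfoldLabel c p s x
  root := unfoldLabel_root s x
  child := by
    intro p
    induction p generalizing s x with
    | nil =>
      intro r g hp i
      rcases h : c s x with t | ⟨f, z⟩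
      · rw [unfoldLabel_inl h] at hp
        simpa [unfoldLabel_inl h] using t.child [] r g hp i
      · rw [unfoldLabel_nil h] at hp
        simp only [Option.some.injEq] at hp
        cases hp
        simpa [unfoldLabel_cons h] using unfoldLabel_root (c := c) _ (z i)
    | cons n p ih =>
      intro r g hp i
      rcases h : c s x with t | ⟨f, z⟩
      · rw [unfoldLabel_inl h] at hp
        simpa [unfoldLabel_inl h] using t.child _ r g hp i
      · by_cases hn : n < σ.arity f
        · simp only [unfoldLabel_cons h, hn, dif_pos] at hp
          simpa [unfoldLabel_cons h, hn] using ih (z ⟨n, hn⟩) r g hp i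
        · simp [unfoldLabel_cons h, hn] at hp
  no_child := by
    intro p
    induction p generalizing s x with
    | nil =>
      intro r g hp m hm
      rcases h : c s x with t | ⟨f, z⟩
      · rw [unfoldLabel_inl h] at hp
        simpa [unfoldLabel_inl h] using t.no_child [] r g hp m hm
      · rw [unfoldLabel_nil h] at hp
        simp only [Option.some.injEq] at hp
        cases hp
        simp [unfoldLabel_cons h, Nat.not_lt.mpr hm]
    | cons n p ih =>
      intro r g hp m hm
      rcases h : c s x with t | ⟨f, z⟩
      · rw [unfoldLabel_inl h] at hp
        simpa [unfoldLabel_inl h] using t.no_child _ r g hp m hm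
      · by_cases hn : n < σ.arity f
        · simp only [unfoldLabel_cons h, hn, dif_pos] at hp
          simpa [unfoldLabel_cons h, hn] using ih (z ⟨n, hn⟩) r g hp m hm
        · simp [unfoldLabel_cons h, hn]
  closed := by
    intro p
    induction p generalizing s x with
    | nil =>
      intro m hp
      obtain ⟨f, hf⟩ := unfoldLabel_root (c := c) s x
      simp [hf] at hp
    | cons n p ih =>
      intro m hp
      rcases h : c s x with t | ⟨f, z⟩
      · rw [unfoldLabel_inl h] at hp
        simpa [unfoldLabel_inl h] using t.closed _ m hp
      · by_cases hn : n < σ.arity f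
        · simp only [unfoldLabel_cons h, hn, dif_pos] at hp
          simpa [unfoldLabel_cons h, hn] using ih (z ⟨n, hn⟩) m hp
        · simp [unfoldLabel_cons h, hn]

variable {c}

theorem unfold_inl {s : σ.Srt} {x : X s} {t : Tree σ s} (h : c s x = .inl t) : unfold c x = t :=
  Tree.ext (funext fun p => unfoldLabel_inl h p)

theorem unfold_inr {s : σ.Srt} {x : X s} {f : σ.Gen s} {z : ∀ i, X (σ.dom f i)}
    (h : c s x = .inr ⟨f, z⟩) : unfold c x = node f (fun i => unfold c (z i)) := by
  refine Tree.ext (funext fun p => ?_)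
  cases p with
  | nil => exact unfoldLabel_nil h
  | cons n p => exact unfoldLabel_cons h n p

theorem unfold_congr {s : σ.Srt} {x y : X s} (h : c s x = c s y) : unfold c x = unfold c y := by
  rcases hy : c s y with t | ⟨f, z⟩
  · rw [unfold_inl hy, unfold_inl (h.trans hy)]
  · rw [unfold_inr hy, unfold_inr (h.trans hy)]

end Unfold

theorem nonempty_of_gen (hgen : ∀ s : σ.Srt, Nonempty (σ.Gen s)) (s : σ.Srt) :
    Nonempty (Tree σ s) :=
  ⟨unfold (X := fun _ => Unit) (fun s _ => .inr ⟨(hgen s).some, fun _ => ()⟩) ()⟩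

@[simp] theorem node_label_nil {s : σ.Srt} (f : σ.Gen s) (ts : ∀ i, Tree σ (σ.dom f i)) :
    (node f ts).label [] = some ⟨s, f⟩ := rfl

theorem node_label_cons {s : σ.Srt} (f : σ.Gen s) (ts : ∀ i, Tree σ (σ.dom f i))
    (i : Fin (σ.arity f)) (p : List ℕ) : (node f ts).label (i.val :: p) = (ts i).label p := by
  simp [node, nodeLabel]

theorem node_label_cons_of_le {s : σ.Srt} (f : σ.Gen s) (ts : ∀ i, Tree σ (σ.dom f i))
    {n : ℕ} (hn : σ.arity f ≤ n) (p : List ℕ) : (node f ts).label (n :: p) = none := by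
  simp [node, nodeLabel, Nat.not_lt.mpr hn]

/-! ### Replacing a subtree of a tree -/

section Graft

open Classical in
/-- The tree `t` with the subtree at position `p` replaced by `t'`. -/
noncomputable def graft {s r : σ.Srt} (t : Tree σ s) (p : List ℕ) (t' : Tree σ r) (f : σ.Gen r)
    (hp : t.label p = some ⟨r, f⟩) (hne : p ≠ []) : Tree σ s where
  label q := if p <+: q then t'.label (q.drop p.length) else t.label q
  root := by simpa [hne] using t.root
  child := by
    intro q k g hq i
    by_cases h : p <+: q
    · obtain ⟨q, rfl⟩ := h
      have h' : p <+: p ++ q ++ [i.val] := by simp [List.append_assoc]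
      rw [if_pos (List.prefix_append _ _)] at hq
      rw [if_pos h']
      simpa [List.append_assoc] using t'.child q k g (by simpa using hq) i
    · rw [if_neg h] at hq
      obtain ⟨e, he⟩ := t.child q k g hq i
      by_cases h' : p <+: q ++ [i.val]
      -- The grafted part can be entered from outside only at `p` itself, where `hp` makes the sorts
      -- agree.
      · have hpq : p = q ++ [i.val] := (List.prefix_concat_iff.mp h').resolve_right h
        obtain ⟨e', he'⟩ := t'.root
        have hr : σ.dom g i = r := by
          rw [hpq, he] at hp
          exact congrArg Sigma.fst (Option.some.inj hp)
        subst hr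
        refine ⟨e', ?_⟩
        rw [if_pos h', ← hpq]
        simpa using he'
      · rw [if_neg h']
        exact ⟨e, he⟩
  no_child := by
    intro q k g hq n hn
    by_cases h : p <+: q
    · obtain ⟨q, rfl⟩ := h
      have h' : p <+: p ++ q ++ [n] := by simp [List.append_assoc]
      rw [if_pos (List.prefix_append _ _)] at hq
      rw [if_pos h']
      simpa [List.append_assoc] using t'.no_child q k g (by simpa using hq) n hn
    · rw [if_neg h] at hq
      have he := t.no_child q k g hq n hn
      by_cases h' : p <+: q ++ [n]
      · have hpq : p = q ++ [n] := (List.prefix_concat_iff.mp h').resolve_right h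
        rw [← hpq, hp] at he
        simp at he
      · rw [if_neg h', he]
  closed := by
    intro q n hq
    by_cases h : p <+: q
    · obtain ⟨q, rfl⟩ := h
      have h' : p <+: p ++ q ++ [n] := by simp [List.append_assoc]
      rw [if_pos (List.prefix_append _ _)] at hq
      rw [if_pos h']
      simpa [List.append_assoc] using t'.closed q n (by simpa using hq)
    · rw [if_neg h] at hq
      have he := t.closed q n hq
      by_cases h' : p <+: q ++ [n]
      · have hpq : p = q ++ [n] := (List.prefix_concat_iff.mp h').resolve_right h
        rw [← hpq, hp] at he
        simp at he
      · rw [if_neg h', he]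

variable {s r : σ.Srt} {t : Tree σ s} {p : List ℕ} {t' : Tree σ r} {f : σ.Gen r}
  {hp : t.label p = some ⟨r, f⟩} {hne : p ≠ []}

theorem graft_label_append (q : List ℕ) : (graft t p t' f hp hne).label (p ++ q) = t'.label q := by
  simp [graft]

theorem graft_label_of_not_prefix {q : List ℕ} (h : ¬ p <+: q) :
    (graft t p t' f hp hne).label q = t.label q := by
  simp [graft, h]

theorem graft_not_isFinite (ht' : ¬ t'.IsFinite) : ¬ (graft t p t' f hp hne).IsFinite := by
  intro h
  refine ht' ((h.preimage (f := fun q => p ++ q)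
    (fun _ _ _ _ h => List.append_cancel_left h)).subset ?_)
  intro q hq
  simpa [nodes, graft_label_append] using hq

end Graft

/-! ### Trees that are subtrees of themselves -/

/-- The tree `t` equals its own subtree at position `q`. -/
def SelfAt {s : σ.Srt} (t : Tree σ s) (q : List ℕ) : Prop := ∀ p, t.label (q ++ p) = t.label p

theorem SelfAt.pow {s : σ.Srt} {t : Tree σ s} {q : List ℕ} (h : t.SelfAt q) (k : ℕ) :
    t.SelfAt (List.replicate k q).flatten := by
  induction k with
  | zero => intro p; simp
  | succ k ih =>
    intro p
    rw [List.replicate_succ, List.flatten_cons, List.append_assoc, h, ih]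

/-- The iterates of `q` are infinitely many distinct positions, each carrying the root label. -/
theorem SelfAt.not_isFinite {s : σ.Srt} {t : Tree σ s} {q : List ℕ} (h : t.SelfAt q)
    (hq : q ≠ []) : ¬ t.IsFinite := by
  intro hfin
  refine Set.infinite_of_injective_forall_mem (f := fun k : ℕ => (List.replicate k q).flatten)
    ?_ ?_ hfin
  · intro j k hjk
    have := congrArg List.length hjk
    simpa [hq] using this
  · intro k
    obtain ⟨f, hf⟩ := t.root
    have := h.pow k []
    simp only [List.append_nil] at this
    simp [nodes, this, hf]

/-- The tree obtained from the self-similar tree `t` by replacing with `t'` the `m`-th iterated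
occurrence of `t` in itself at position `p`. -/
noncomputable def graftIter {s : σ.Srt} (t t' : Tree σ s) (p : List ℕ) (f : σ.Gen s)
    (hp : t.label p = some ⟨s, f⟩) (hne : p ≠ []) : ℕ → Tree σ s
  | 0 => t'
  | m + 1 => graft t p (graftIter t t' p f hp hne m) f hp hne

section GraftIter

variable {s : σ.Srt} {t t' : Tree σ s} {p : List ℕ} {f : σ.Gen s}
  {hp : t.label p = some ⟨s, f⟩} {hne : p ≠ []}

theorem graftIter_not_isFinite (ht' : ¬ t'.IsFinite) (m : ℕ) :
    ¬ (graftIter t t' p f hp hne m).IsFinite := by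
  induction m with
  | zero => exact ht'
  | succ m ih => exact graft_not_isFinite ih

/-- Otherwise `t'` would arise by grafting from itself along `p`, the recursion that `t` solves too,
and the solution is unique: a label below `p` is a label of the preceding iterate at a shorter
position, and all other labels come from `t`. -/
theorem graftIter_ne_zero (hself : t.SelfAt p) (htt' : t' ≠ t) (k : ℕ) :
    graftIter t t' p f hp hne (k + 1) ≠ t' := by
  intro hk
  refine htt' (Tree.ext (funext fun q => ?_))
  suffices H : ∀ n (q : List ℕ), q.length = n →
      ∀ m, (graftIter t t' p f hp hne m).label q = t.label q from H _ q rfl 0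
  intro n
  induction n using Nat.strong_induction_on with
  | _ n ih =>
    intro q hq
    have hsucc : ∀ m, (graftIter t t' p f hp hne (m + 1)).label q = t.label q := by
      intro m
      by_cases h : p <+: q
      · obtain ⟨q, rfl⟩ := h
        rw [graftIter, graft_label_append, hself q]
        refine ih q.length ?_ q rfl m
        have := List.length_pos_iff.mpr hne
        rw [← hq, List.length_append]
        omega
      · rw [graftIter, graft_label_of_not_prefix h]
    intro m
    cases m with
    -- The cycle closes here: the initial tree is replaced by the iterate `k + 1`, to which `hsucc`
    -- applies.
    | zero => rw [← hsucc k, hk]; rfl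
    | succ m => exact hsucc m

theorem graftIter_succ_injective {m n : ℕ}
    (h : graftIter t t' p f hp hne (m + 1) = graftIter t t' p f hp hne (n + 1)) :
    graftIter t t' p f hp hne m = graftIter t t' p f hp hne n := by
  refine Tree.ext (funext fun q => ?_)
  have := congrArg (fun t => t.label (p ++ q)) h
  simpa only [graftIter, graft_label_append] using this

theorem graftIter_injective (hself : t.SelfAt p) (htt' : t' ≠ t) :
    Function.Injective (graftIter t t' p f hp hne) := by
  intro m
  induction m with
  | zero =>
    intro n h
    cases n with
    | zero => rfl
    | succ n => exact absurd h.symm (graftIter_ne_zero hself htt' n)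
  | succ m ih =>
    intro n h
    cases n with
    | zero => exact absurd h (graftIter_ne_zero hself htt' m)
    | succ n => exact congrArg Nat.succ (ih (graftIter_succ_injective h))

end GraftIter

/-- If almost all infinite trees recur at a position in `Q`, take such a `t`, recurring at `p`, and
graft another infinite tree deeper and deeper along `p`. An iterate recurring at `p` would equal its
predecessor. One recurring at another `q` in `Q` equals the subtree of `t` at `q`, because positions
of equal length are incomparable. Only finitely many trees are left for infinitely many distinct
iterates. -/
theorem infinite_not_selfAt_of_length_eq {s : σ.Srt} (hs : (σ.infTrees s).Infinite)
    (Q : Finset (List ℕ)) {L : ℕ} (hL : 0 < L) (hQ : ∀ q ∈ Q, q.length = L) :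
    {t ∈ σ.infTrees s | ∀ q ∈ Q, ¬ t.SelfAt q}.Infinite := by
  intro hfin
  obtain ⟨t, ht, ht'⟩ := hs.exists_notMem_finite hfin
  simp only [Set.mem_ofPred_eq, ht, true_and, not_forall, not_not] at ht'
  obtain ⟨p, hpQ, hself⟩ := ht'
  obtain ⟨t', ht'inf, htt'⟩ := hs.exists_notMem_finite (Set.finite_singleton t)
  obtain ⟨f, hf⟩ := t.root
  have hp : t.label p = some ⟨s, f⟩ := by
    rw [← hf]; simpa using hself []
  have hne : p ≠ [] := List.length_pos_iff.mp (by rw [hQ p hpQ]; exact hL)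
  have hinj := graftIter_injective (hp := hp) (hne := hne) hself htt'
  -- Labellings are compared instead of trees, since `t` need not have a subtree of sort `s` at
  -- every `q` in `Q`.
  have hinj' : Function.Injective fun m => (graftIter t t' p f hp hne (m + 1)).label := by
    intro m n h
    exact Nat.succ_injective (hinj (Tree.ext h))
  refine Set.infinite_of_injective_forall_mem hinj' ?_
    ((hfin.image Tree.label).union (Q.finite_toSet.image (fun q r => t.label (q ++ r))))
  intro m
  by_cases hm : ∀ q ∈ Q, ¬ (graftIter t t' p f hp hne (m + 1)).SelfAt q
  · exact .inl ⟨_, ⟨graftIter_not_isFinite ht'inf _, hm⟩, rfl⟩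
  · push Not at hm
    obtain ⟨q, hqQ, hq⟩ := hm
    refine .inr ⟨q, hqQ, funext fun r => ?_⟩
    by_cases hqp : q = p
    · subst hqp
      refine absurd (hinj (a₁ := m + 1) (a₂ := m) (Tree.ext (funext fun r => ?_))) (by omega)
      rw [← hq r, graftIter, graft_label_append]
    · rw [← hq r, graftIter, graft_label_of_not_prefix]
      intro h
      refine hqp ?_
      exact ((List.prefix_of_prefix_length_le h (List.prefix_append q r)
        (by rw [hQ p hpQ, hQ q hqQ])).eq_of_length (by rw [hQ p hpQ, hQ q hqQ])).symm

/-- Recurrence at `q` implies recurrence at its powers, so all positions can be brought to one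
common length, the product of the lengths. -/
theorem infinite_not_selfAt {s : σ.Srt} (hs : (σ.infTrees s).Infinite)
    (Q : Finset (List ℕ)) (hQ : ∀ q ∈ Q, q ≠ []) :
    {t ∈ σ.infTrees s | ∀ q ∈ Q, ¬ t.SelfAt q}.Infinite := by
  classical
  set L := ∏ q ∈ Q, q.length
  have hpos : 0 < L := Finset.prod_pos fun q hq => List.length_pos_iff.mpr (hQ q hq)
  refine (infinite_not_selfAt_of_length_eq hs
    (Q.image fun q => (List.replicate (L / q.length) q).flatten) hpos ?_).mono ?_
  · intro q' hq'
    obtain ⟨q, hq, rfl⟩ := Finset.mem_image.mp hq'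
    simpa using Nat.div_mul_cancel (Finset.dvd_prod_of_mem List.length hq)
  · rintro t ⟨ht, h⟩
    exact ⟨ht, fun q hq hself => h _ (Finset.mem_image_of_mem _ hq) (hself.pow _)⟩

/-! ### Thin sets of trees -/

/-- Three kinds of small sets of trees of sort `s`; see `exists_mem_of_thin`. -/
inductive Thin {s : σ.Srt} (P : Set (Tree σ s)) : Prop
  | subsingleton (h : P.Subsingleton)
  | selfAt (f : σ.Gen s) (q : List ℕ) (hq : q ≠ [])
      (h : ∀ t ∈ P, t.label [] = some ⟨s, f⟩ ∧ t.SelfAt q)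
  | root (f : σ.Gen s) (hinf : Infinite (σ.Gen s)) (h : ∀ t ∈ P, t.label [] = some ⟨s, f⟩)

/-- This lets infinitely many available roots defeat finitely many thin sets. -/
theorem Thin.rootGens_subsingleton {s : σ.Srt} {P : Set (Tree σ s)} (h : Thin P) :
    (σ.rootGens P).Subsingleton := by
  rintro f ⟨t, ht, hf⟩ g ⟨t', ht', hg⟩
  suffices H : (some ⟨s, f⟩ : Option (Σ r : σ.Srt, σ.Gen r)) = some ⟨s, g⟩ by
    simpa using H
  rcases h with h | ⟨k, q, -, h⟩ | ⟨k, -, h⟩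
  · rw [← hf, ← hg, h ht ht']
  · rw [← hf, ← hg, (h t ht).1, (h t' ht').1]
  · rw [← hf, ← hg, h t ht, h t' ht']

/-- The set `K` is not covered by finitely many thin sets. -/
def Rich {s : σ.Srt} (K : Set (Tree σ s)) : Prop :=
  ∀ S : Set (Set (Tree σ s)), S.Finite → (∀ P ∈ S, Thin P) → ∃ t ∈ K, ∀ P ∈ S, t ∉ P

theorem rich_of_rootGens_infinite {s : σ.Srt} {K : Set (Tree σ s)}
    (hK : (σ.rootGens K).Infinite) : Rich K := by
  intro S hS hthin
  obtain ⟨f, ⟨t, ht, hf⟩, hnot⟩ := hK.exists_notMem_finite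
    (hS.biUnion fun P hP => (hthin P hP).rootGens_subsingleton.finite)
  refine ⟨t, ht, fun P hP htP => hnot ?_⟩
  exact Set.mem_biUnion hP ⟨t, htP, hf⟩

/-- With finitely many generators the third kind of thin set cannot occur. The sets of the second
kind contribute their positions to `Q`, and the subsingletons remove only finitely many further
trees. -/
theorem rich_of_infinite_not_selfAt {s : σ.Srt} {K : Set (Tree σ s)} [Finite (σ.Gen s)]
    (hK : ∀ Q : Finset (List ℕ), (∀ q ∈ Q, q ≠ []) → {t ∈ K | ∀ q ∈ Q, ¬ t.SelfAt q}.Infinite) :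
    Rich K := by
  classical
  intro S hS hthin
  have key : ∀ P : Set (Tree σ s), ∃ q : List ℕ, q ≠ [] ∧
      (P ∈ S → P.Subsingleton ∨ ∀ t ∈ P, t.SelfAt q) := by
    intro P
    by_cases hP : P ∈ S
    · rcases hthin P hP with h | ⟨f, q, hq, h⟩ | ⟨f, hinf, h⟩
      -- The position `[0]` is an arbitrary nonempty default.
      · exact ⟨[0], by simp, fun _ => .inl h⟩
      · exact ⟨q, hq, fun _ => .inr fun t ht => (h t ht).2⟩
      · exact absurd ‹Finite (σ.Gen s)› (not_finite_iff_infinite.mpr hinf)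
    · exact ⟨[0], by simp, fun h => absurd h hP⟩
  choose q hq hqS using key
  have hfin : (⋃ P ∈ {P ∈ S | P.Subsingleton}, P).Finite :=
    (hS.subset (Set.sep_subset _ _)).biUnion fun P hP => hP.2.finite
  obtain ⟨t, ⟨htK, ht⟩, hnot⟩ := (hK (hS.toFinset.image q) (by
    intro p hp
    obtain ⟨P, -, rfl⟩ := Finset.mem_image.mp hp
    exact hq P)).exists_notMem_finite hfin
  refine ⟨t, htK, fun P hP htP => ?_⟩
  rcases hqS P hP with h | h
  · exact hnot (Set.mem_biUnion (show P ∈ {P ∈ S | P.Subsingleton} from ⟨hP, h⟩) htP)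
  · exact ht _ (Finset.mem_image_of_mem _ (hS.mem_toFinset.mpr hP)) (h t htP)

theorem rootGens_eq_univ (hgen : ∀ s : σ.Srt, Nonempty (σ.Gen s)) {s : σ.Srt}
    {K : Set (Tree σ s)} (hK : ∀ t, t ∈ K) : σ.rootGens K = Set.univ := by
  refine Set.eq_univ_of_forall fun f => ?_
  exact ⟨node f fun i => (nonempty_of_gen hgen _).some, hK _, rfl⟩

theorem rich_finTrees (hgen : ∀ s : σ.Srt, Nonempty (σ.Gen s)) {s : σ.Srt}
    (hroot : σ.RootDiverse s) (hs : s ∉ σ.SFF) : Rich (σ.finTrees s) := by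
  have hinf : (σ.finTrees s).Infinite := hs
  rcases finite_or_infinite (σ.Gen s) with h | h
  · refine rich_of_infinite_not_selfAt fun Q hQ => hinf.mono fun t ht => ⟨ht, fun q hq hself => ?_⟩
    exact hself.not_isFinite (hQ q hq) ht
  · refine rich_of_rootGens_infinite ?_
    -- `RootDiverse` says nothing when every tree of the sort is finite, but then every generator is
    -- the root of a finite tree.
    rcases (σ.infTrees s).eq_empty_or_nonempty with he | hne
    · rw [rootGens_eq_univ hgen]
      · exact Set.infinite_univ
      · intro t
        by_contra ht
        exact (he ▸ ht : t ∈ (∅ : Set (Tree σ s)))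
    · exact (hroot h hinf.nonempty hne).1 hs

theorem rich_infTrees (hgen : ∀ s : σ.Srt, Nonempty (σ.Gen s)) {s : σ.Srt}
    (hroot : σ.RootDiverse s) (hs : s ∉ σ.SFI) : Rich (σ.infTrees s) := by
  have hinf : (σ.infTrees s).Infinite := hs
  rcases finite_or_infinite (σ.Gen s) with h | h
  · exact rich_of_infinite_not_selfAt fun Q hQ => infinite_not_selfAt hinf Q hQ
  · refine rich_of_rootGens_infinite ?_
    rcases (σ.finTrees s).eq_empty_or_nonempty with he | hne
    · rw [rootGens_eq_univ hgen]
      · exact Set.infinite_univ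
      · intro t ht
        exact (he ▸ (show t ∈ σ.finTrees s from ht) : t ∈ (∅ : Set (Tree σ s)))
    · exact (hroot h hne hinf.nonempty).2 hs

end Tree

variable {σ : Signature.{u, v}} {V : σ.Srt → Type w}

/-! ### Truth and free variables of compound formulas -/

namespace Formula

theorem holds_conj {ρ : Valuation σ V} {l : List (Formula σ V)} :
    (conj l).Holds ρ ↔ ∀ c ∈ l, c.Holds ρ := by
  induction l with
  | nil => simp [conj, Holds]
  | cons c l ih =>
    rw [List.forall_mem_cons, ← ih]
    rfl

theorem holds_exs {ρ : Valuation σ V} {xs : List (Var σ V)} {φ : Formula σ V} :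
    (exs xs φ).Holds ρ ↔
      ∃ ρ' : Valuation σ V, (∀ x ∉ xs, ρ' x.1 x.2 = ρ x.1 x.2) ∧ φ.Holds ρ' := by
  classical
  induction xs generalizing ρ with
  | nil =>
    constructor
    · exact fun h => ⟨ρ, fun _ _ => rfl, h⟩
    · rintro ⟨ρ', h, h'⟩
      have : ρ' = ρ := funext fun s => funext fun y => h ⟨s, y⟩ List.not_mem_nil
      rwa [this] at h'
  | cons x xs ih =>
    change (∃ ρ₁ : Valuation σ V, _ ∧ (exs xs φ).Holds ρ₁) ↔ _
    simp only [ih]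
    constructor
    · rintro ⟨ρ₁, h₁, ρ', h', hφ⟩
      refine ⟨ρ', fun y hy => ?_, hφ⟩
      rw [List.mem_cons, not_or] at hy
      rw [h' y hy.2, h₁ y.1 y.2 hy.1]
    · rintro ⟨ρ', h', hφ⟩
      -- The intermediate valuation changes `ρ` at `x` only, to the final value there.
      refine ⟨fun s y => Function.update (fun z : Var σ V => ρ z.1 z.2) x (ρ' x.1 x.2) ⟨s, y⟩,
        fun s y hy => Function.update_of_ne hy .., ρ', fun y hy => ?_, hφ⟩
      by_cases hyx : y = x
      · subst hyx
        exact (Function.update_self y _ fun z : Var σ V => ρ z.1 z.2).symm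
      · rw [h' y (by simp [hyx, hy])]
        exact (Function.update_of_ne hyx _ fun z : Var σ V => ρ z.1 z.2).symm

theorem mem_freeVars_conj {x : Var σ V} {l : List (Formula σ V)} :
    x ∈ (conj l).freeVars ↔ ∃ c ∈ l, x ∈ c.freeVars := by
  induction l with
  | nil => simp [conj, freeVars]
  | cons c l ih =>
    rw [List.exists_mem_cons_iff, ← ih]
    rfl

theorem mem_freeVars_exs {x : Var σ V} {xs : List (Var σ V)} {φ : Formula σ V} :
    x ∈ (exs xs φ).freeVars ↔ x ∉ xs ∧ x ∈ φ.freeVars := by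
  induction xs with
  | nil => simp [exs]
  | cons y xs ih =>
    change x ∈ (exs xs φ).freeVars \ {y} ↔ _
    rw [Set.mem_sdiff, ih, Set.mem_singleton_iff, List.mem_cons]
    tauto

end Formula

/-! ### Solved systems of equations -/

/-- The valuation `ρ` satisfies all equations of `α`. -/
def BasicFormula.SatEqs (α : BasicFormula σ V) (ρ : Valuation σ V) : Prop :=
  ∀ e ∈ α.eqs, ρ e.sort e.lhs = e.rhs.toTerm.eval ρ

/-- The variable `x` is not the left-hand side of an equation of `α`. -/
def BasicFormula.IsParam (α : BasicFormula σ V) (x : Var σ V) : Prop :=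
  ∀ e ∈ α.eqs, e.lhsVar ≠ x

theorem FlatTerm.toTerm_injective {s : σ.Srt} :
    Function.Injective (FlatTerm.toTerm : FlatTerm σ V s → Term σ V s) := by
  intro t t' h
  cases t <;> cases t' <;> simp only [FlatTerm.toTerm, Term.var.injEq, Term.app.injEq,
    reduceCtorEq] at h
  · rw [h]
  · obtain ⟨rfl, h⟩ := h
    have := eq_of_heq h
    congr 1
    funext i
    simpa using congrFun this i

theorem Equation.toFormula_injective :
    Function.Injective (Equation.toFormula : Equation σ V → Formula σ V) := by
  rintro ⟨s, x, t⟩ ⟨s', x', t'⟩ h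
  simp only [Equation.toFormula, Formula.eq.injEq] at h
  obtain ⟨rfl, h, h'⟩ := h
  have h := eq_of_heq h
  simp only [Term.var.injEq] at h
  rw [h, FlatTerm.toTerm_injective (eq_of_heq h')]

namespace BasicFormula

variable {α : BasicFormula σ V} {lt : Var σ V → Var σ V → Prop}

theorem mem_atoms {c : Formula σ V} :
    c ∈ α.atoms ↔ (∃ e ∈ α.eqs, e.toFormula = c) ∨ ∃ x ∈ α.fins, finAtom x = c := by
  simp [atoms]

theorem toFormula_mem_atoms {e : Equation σ V} : e.toFormula ∈ α.atoms ↔ e ∈ α.eqs := by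
  rw [mem_atoms]
  constructor
  · rintro (⟨e', he', h⟩ | ⟨x, hx, h⟩)
    · rwa [← Equation.toFormula_injective h]
    · simp [Equation.toFormula, finAtom] at h
  · exact fun h => .inl ⟨e, h, rfl⟩

theorem finAtom_mem_atoms {x : Var σ V} : finAtom x ∈ α.atoms ↔ x ∈ α.fins := by
  rw [mem_atoms]
  constructor
  · rintro (⟨e', he', h⟩ | ⟨⟨s, y⟩, hy, h⟩)
    · simp [Equation.toFormula, finAtom] at h
    · obtain ⟨s', x⟩ := x
      simp only [finAtom, Formula.fin.injEq] at h
      obtain ⟨rfl, h⟩ := h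
      have h := eq_of_heq h
      simp only [Term.var.injEq] at h
      rwa [← h]
  · exact fun h => .inr ⟨x, h, rfl⟩

theorem holds_toFormula {ρ : Valuation σ V} :
    α.toFormula.Holds ρ ↔ α.SatEqs ρ ∧ ∀ x ∈ α.fins, (ρ x.1 x.2).IsFinite := by
  rw [toFormula, Formula.holds_conj, atoms, List.forall_mem_append, List.forall_mem_map, List.forall_mem_map]
  rfl

theorem IsSolved.eq_of_lhsVar_eq (h : α.IsSolved lt) {e e' : Equation σ V} (he : e ∈ α.eqs)
    (he' : e' ∈ α.eqs) (hee' : e.lhsVar = e'.lhsVar) : e = e' :=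
  List.inj_on_of_nodup_map h.distinct.of_append_left he he' hee'

theorem IsSolved.rhs_eq (h : α.IsSolved lt) {s : σ.Srt} {x : V s} {t t' : FlatTerm σ V s}
    (he : ⟨s, x, t⟩ ∈ α.eqs) (he' : ⟨s, x, t'⟩ ∈ α.eqs) : t = t' := by
  have := h.eq_of_lhsVar_eq he he' rfl
  simpa using this

theorem IsSolved.isParam_of_mem_fins (h : α.IsSolved lt) {x : Var σ V} (hx : x ∈ α.fins) :
    α.IsParam x := by
  rintro e he rfl
  exact (List.nodup_append.mp h.distinct).2.2 _ (List.mem_map_of_mem he) _ hx rfl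

theorem isParam_or {s : σ.Srt} (x : V s) :
    α.IsParam ⟨s, x⟩ ∨ (∃ y, ⟨s, x, .var y⟩ ∈ α.eqs) ∨
      ∃ (f : σ.Gen s) (z : ∀ i, V (σ.dom f i)), ⟨s, x, .app f z⟩ ∈ α.eqs := by
  by_cases h : α.IsParam ⟨s, x⟩
  · exact .inl h
  · simp only [IsParam, not_forall, not_not] at h
    obtain ⟨⟨s', x', t⟩, he, hx⟩ := h
    simp only [Equation.lhsVar, Sigma.mk.injEq] at hx
    obtain ⟨rfl, hx⟩ := hx
    obtain rfl := eq_of_heq hx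
    cases t with
    | var y => exact .inr (.inl ⟨y, he⟩)
    | app f z => exact .inr (.inr ⟨f, z, he⟩)

theorem step_var {s : σ.Srt} {x y : V s} (h : ⟨s, x, .var y⟩ ∈ α.eqs) :
    α.Step ⟨s, x⟩ ⟨s, y⟩ :=
  ⟨_, h, rfl, by simp [FlatTerm.toTerm, Term.vars]⟩

theorem step_app {s : σ.Srt} {x : V s} {f : σ.Gen s} {z : ∀ i, V (σ.dom f i)}
    (h : ⟨s, x, .app f z⟩ ∈ α.eqs) (i : Fin (σ.arity f)) : α.Step ⟨s, x⟩ ⟨_, z i⟩ :=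
  ⟨_, h, rfl, by simp only [FlatTerm.toTerm, Term.vars, Set.mem_iUnion]; exact ⟨i, rfl⟩⟩

theorem step_cases {x y : Var σ V} (h : α.Step x y) :
    (∃ (s : σ.Srt) (x' y' : V s), x = ⟨s, x'⟩ ∧ y = ⟨s, y'⟩ ∧ ⟨s, x', .var y'⟩ ∈ α.eqs) ∨
    ∃ (s : σ.Srt) (x' : V s) (f : σ.Gen s) (z : ∀ i, V (σ.dom f i)) (i : Fin (σ.arity f)),
      x = ⟨s, x'⟩ ∧ y = ⟨_, z i⟩ ∧ ⟨s, x', .app f z⟩ ∈ α.eqs := by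
  obtain ⟨⟨s, x', t⟩, he, rfl, hy⟩ := h
  cases t with
  | var y' =>
    simp only [FlatTerm.toTerm, Term.vars, Set.mem_singleton_iff] at hy
    exact .inl ⟨s, x', y', rfl, hy, he⟩
  | app f z =>
    simp only [FlatTerm.toTerm, Term.vars, Set.mem_iUnion, Set.mem_singleton_iff] at hy
    obtain ⟨i, hi⟩ := hy
    exact .inr ⟨s, x', f, z, i, rfl, hi, he⟩

/-- The relation `x = y ∈ α` is well-founded as a relation between `y` and `x`. -/
theorem IsSolved.wellFounded_varEq [IsStrictTotalOrder (Var σ V) lt] (h : α.IsSolved lt)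
    (s : σ.Srt) : WellFounded fun y x : V s => ⟨s, x, .var y⟩ ∈ α.eqs := by
  set A : Set (V s) := {y | ∃ x, ⟨s, x, .var y⟩ ∈ α.eqs} with hA
  have hfin : A.Finite := by
    refine Set.Finite.of_finite_image (f := fun y : V s => (⟨s, .var y⟩ :
      Σ s, FlatTerm σ V s)) ?_ ?_
    · refine (List.finite_toSet (α.eqs.map fun e => (⟨e.sort, e.rhs⟩ :
        Σ s, FlatTerm σ V s))).subset ?_
      rintro _ ⟨y, ⟨x, hx⟩, rfl⟩
      exact List.mem_map.mpr ⟨_, hx, rfl⟩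
    · intro y _ y' _ hy
      simpa using hy
  -- The order on all variables need not be well-founded; counting the finitely many right-hand
  -- sides below a variable gives a natural number that drops along each equation.
  refine Subrelation.wf (r := InvImage (· < ·) fun x : V s => {z ∈ A | lt ⟨s, z⟩ ⟨s, x⟩}.ncard) ?_
    (InvImage.wf _ wellFounded_lt)
  intro y x hxy
  refine Set.ncard_lt_ncard ?_ (hfin.subset (Set.sep_subset _ _))
  have hlt := h.ordered s x y hxy
  refine ⟨fun z hz => ⟨hz.1, _root_.trans hz.2 hlt⟩, fun hsub => ?_⟩
  exact irrefl_of lt _ (hsub (show y ∈ {z ∈ A | lt ⟨s, z⟩ ⟨s, x⟩} from ⟨⟨x, hxy⟩, hlt⟩)).2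

/-- A variable that is not the left-hand side of an equation `x = y` and that is equal to the
given variable by equations of this form. -/
theorem IsSolved.exists_representative [IsStrictTotalOrder (Var σ V) lt] (h : α.IsSolved lt)
    (s : σ.Srt) : ∃ rep : V s → V s, (∀ x, (∀ y, ⟨s, x, .var y⟩ ∉ α.eqs) → rep x = x) ∧
      ∀ x y, ⟨s, x, .var y⟩ ∈ α.eqs → rep x = rep y := by
  classical
  have wf := h.wellFounded_varEq s
  let F : ∀ x : V s, (∀ y : V s, ⟨s, x, .var y⟩ ∈ α.eqs → V s) → V s := fun x ih =>
    if hx : ∃ y, ⟨s, x, .var y⟩ ∈ α.eqs then ih _ hx.choose_spec else x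
  refine ⟨wf.fix F, fun x hx => ?_, fun x y hxy => ?_⟩
  · rw [wf.fix_eq]
    exact dif_neg (by simpa using hx)
  · have hx : ∃ y, ⟨s, x, .var y⟩ ∈ α.eqs := ⟨y, hxy⟩
    have hy : hx.choose = y := by simpa using h.rhs_eq hx.choose_spec hxy
    rw [wf.fix_eq]
    exact (dif_pos hx).trans (congrArg (wf.fix F) hy)

/-- A solved system of equations has a solution for all values of the parameters. -/
theorem IsSolved.exists_satEqs [IsStrictTotalOrder (Var σ V) lt] (h : α.IsSolved lt)
    (ρ : Valuation σ V) :
    ∃ ρ' : Valuation σ V, α.SatEqs ρ' ∧ ∀ x : Var σ V, α.IsParam x → ρ' x.1 x.2 = ρ x.1 x.2 := by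
  classical
  choose rep hrep hrep' using h.exists_representative
  -- The variables are the states: a representative with an equation `x = f(z)` is expanded by it,
  -- and any other representative is a parameter, replaced by its prescribed tree.
  let c : ∀ s, V s → Tree σ s ⊕ (Σ f : σ.Gen s, ∀ i, V (σ.dom f i)) := fun s x =>
    if hx : ∃ fz : Σ f : σ.Gen s, ∀ i, V (σ.dom f i), ⟨s, rep s x, .app fz.1 fz.2⟩ ∈ α.eqs
    then .inr hx.choose else .inl (ρ s (rep s x))
  have hc : ∀ s (x y : V s), rep s x = rep s y → c s x = c s y := by
    intro s x y hxy
    simp only [c, hxy]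
  refine ⟨fun s x => Tree.unfold c x, ?_, ?_⟩
  · rintro ⟨s, x, t⟩ he
    cases t with
    | var y => exact Tree.unfold_congr (hc s x y (hrep' s x y he))
    | app f z =>
      have hx : rep s x = x := hrep s x fun y hy => by simpa using h.rhs_eq he hy
      have hex : ∃ fz : Σ f : σ.Gen s, ∀ i, V (σ.dom f i),
          ⟨s, rep s x, .app fz.1 fz.2⟩ ∈ α.eqs := ⟨⟨f, z⟩, hx.symm ▸ he⟩
      have hch : hex.choose = ⟨f, z⟩ := by
        have h1 := hex.choose_spec
        have h2 : ⟨s, rep s x, .app f z⟩ ∈ α.eqs := hx.symm ▸ he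
        have := h.rhs_eq h1 h2
        simp only [FlatTerm.app.injEq] at this
        exact Sigma.ext this.1 this.2
      have hcx : c s x = .inr ⟨f, z⟩ := by
        rw [← hch]
        exact dif_pos hex
      exact Tree.unfold_inr hcx
  · rintro ⟨s, x⟩ hx
    have hrx : rep s x = x := hrep s x fun y hy => hx _ hy rfl
    have hcx : c s x = .inl (ρ s x) := by
      have : ¬ ∃ fz : Σ f : σ.Gen s, ∀ i, V (σ.dom f i),
          ⟨s, rep s x, .app fz.1 fz.2⟩ ∈ α.eqs := by
        rintro ⟨fz, hfz⟩
        rw [hrx] at hfz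
        exact hx _ hfz rfl
      refine (dif_neg this).trans ?_
      rw [hrx]
    exact Tree.unfold_inl hcx

/-- The solution of a solved system of equations is determined by the reachable parameters. -/
theorem IsSolved.eq_of_satEqs [IsStrictTotalOrder (Var σ V) lt] (h : α.IsSolved lt)
    {ρ ρ' : Valuation σ V} (hρ : α.SatEqs ρ) (hρ' : α.SatEqs ρ') {s : σ.Srt} (x : V s)
    (hx : ∀ z : Var σ V, α.Reachable ⟨s, x⟩ z → α.IsParam z → ρ z.1 z.2 = ρ' z.1 z.2) :
    ρ s x = ρ' s x := by
  refine Tree.ext (funext fun p => ?_)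
  -- The induction is lexicographic: function symbols shorten the position, while equations between
  -- variables keep it and need the inner well-founded induction.
  induction p generalizing s x with
  | nil =>
    induction x using (h.wellFounded_varEq s).induction with
    | _ x ih =>
      rcases α.isParam_or x with hp | ⟨y, hy⟩ | ⟨f, z, hz⟩
      · rw [hx _ .refl hp]
      · rw [show ρ s x = ρ s y from hρ _ hy, show ρ' s x = ρ' s y from hρ' _ hy]
        exact ih y hy fun z hz => hx z (.head (step_var hy) hz)
      · rw [show ρ s x = Tree.node f _ from hρ _ hz, show ρ' s x = Tree.node f _ from hρ' _ hz]
        rfl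
  | cons n p ihp =>
    induction x using (h.wellFounded_varEq s).induction with
    | _ x ih =>
      rcases α.isParam_or x with hp | ⟨y, hy⟩ | ⟨f, z, hz⟩
      · rw [hx _ .refl hp]
      · rw [show ρ s x = ρ s y from hρ _ hy, show ρ' s x = ρ' s y from hρ' _ hy]
        exact ih y hy fun z hz => hx z (.head (step_var hy) hz)
      · rw [show ρ s x = Tree.node f _ from hρ _ hz, show ρ' s x = Tree.node f _ from hρ' _ hz]
        by_cases hn : n < σ.arity f
        · rw [Tree.node_label_cons f _ ⟨n, hn⟩, Tree.node_label_cons f _ ⟨n, hn⟩]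
          exact ihp (z ⟨n, hn⟩) fun y hy => hx y (.head (step_app hz _) hy)
        · rw [Tree.node_label_cons_of_le f _ (not_lt.mp hn),
            Tree.node_label_cons_of_le f _ (not_lt.mp hn)]

/-- If `y` is reachable from `x`, then in all solutions the value of `y` is the subtree of the
value of `x` at a fixed position. -/
theorem IsSolved.exists_position [IsStrictTotalOrder (Var σ V) lt] (h : α.IsSolved lt)
    {x y : Var σ V} (hxy : α.Reachable x y) :
    ∃ q : List ℕ, (q = [] → x = y ∨ lt y x) ∧
      (q ≠ [] → ∃ f : σ.Gen x.1, ∀ ρ, α.SatEqs ρ → (ρ x.1 x.2).label [] = some ⟨x.1, f⟩) ∧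
      ∀ ρ, α.SatEqs ρ → ∀ p, (ρ x.1 x.2).label (q ++ p) = (ρ y.1 y.2).label p := by
  induction hxy using Relation.ReflTransGen.head_induction_on with
  | refl => exact ⟨[], fun _ => .inl rfl, fun h => absurd rfl h, fun _ _ _ => rfl⟩
  | @head a b hab _ ih =>
    obtain ⟨q, hq, hroot, hpos⟩ := ih
    -- An equation between variables keeps the position and descends in the order; a function symbol
    -- lengthens the position and fixes the root.
    rcases step_cases hab with ⟨s, a', b', rfl, rfl, he⟩ | ⟨s, a', f, z, i, rfl, rfl, he⟩
    · have hval : ∀ ρ, α.SatEqs ρ → ρ s a' = ρ s b' := fun ρ hρ => hρ _ he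
      refine ⟨q, fun hnil => .inr ?_, fun hne => ?_, fun ρ hρ p => ?_⟩
      · have hlt := h.ordered s a' b' he
        rcases hq hnil with heq | h'
        · rwa [← heq]
        · exact _root_.trans h' hlt
      · obtain ⟨f, hf⟩ := hroot hne
        refine ⟨f, fun ρ hρ => ?_⟩
        simp only [hval ρ hρ]
        exact hf ρ hρ
      · simp only [hval ρ hρ]
        exact hpos ρ hρ p
    · have hval : ∀ ρ, α.SatEqs ρ → ρ s a' = Tree.node f fun i => ρ _ (z i) :=
        fun ρ hρ => hρ _ he
      refine ⟨i.val :: q, by simp, fun _ => ⟨f, fun ρ hρ => ?_⟩, fun ρ hρ p => ?_⟩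
      · simp only [hval ρ hρ, Tree.node_label_nil]
      · simp only [hval ρ hρ, List.cons_append, Tree.node_label_cons]
        exact hpos ρ hρ p

/-- The first step of the cycle must use the given equation, hence descends below `f`; this keeps
the position nonempty whatever equations follow. -/
theorem exists_position_of_app [IsStrictTotalOrder (Var σ V) lt] (h : α.IsSolved lt)
    {s : σ.Srt} {x : V s} {f : σ.Gen s} {z : ∀ i, V (σ.dom f i)}
    (he : ⟨s, x, .app f z⟩ ∈ α.eqs) (hxx : α.ProperlyReachable ⟨s, x⟩ ⟨s, x⟩) :
    ∃ q : List ℕ, q ≠ [] ∧ ∀ ρ, α.SatEqs ρ → (ρ s x).SelfAt q := by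
  obtain ⟨b, hb, hbx⟩ := Relation.TransGen.head'_iff.mp hxx
  obtain ⟨q, -, -, hpos⟩ := h.exists_position hbx
  have : ∃ i, b = ⟨_, z i⟩ := by
    obtain ⟨e, he', hx, hb⟩ := hb
    obtain rfl := h.eq_of_lhsVar_eq he' he hx
    simpa [FlatTerm.toTerm, Term.vars, eq_comm] using hb
  obtain ⟨i, rfl⟩ := this
  refine ⟨i.val :: q, by simp, fun ρ hρ p => ?_⟩
  have hval : ρ s x = Tree.node f fun i => ρ _ (z i) := hρ _ he
  conv_lhs => rw [hval]
  rw [List.cons_append, Tree.node_label_cons]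
  exact hpos ρ hρ p

/-- Variables under `fin` are parameters of sorts with a finite tree, so they receive finite values
before the equations are solved. -/
theorem IsSolved.exists_holds [IsStrictTotalOrder (Var σ V) lt] (h : α.IsSolved lt)
    (hgen : ∀ s : σ.Srt, Nonempty (σ.Gen s)) : ∃ ρ, α.toFormula.Holds ρ := by
  classical
  have : ∀ x : Var σ V, ∃ t : Tree σ x.1, x ∈ α.fins → t.IsFinite := by
    intro x
    by_cases hx : x ∈ α.fins
    · obtain ⟨t, ht⟩ := (h.fin_sorts x hx).1
      exact ⟨t, fun _ => ht⟩
    · exact ⟨(Tree.nonempty_of_gen hgen _).some, fun h => absurd h hx⟩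
  choose t ht using this
  obtain ⟨ρ, hρ, hpar⟩ := h.exists_satEqs fun s x => t ⟨s, x⟩
  refine ⟨ρ, holds_toFormula.mpr ⟨hρ, fun x hx => ?_⟩⟩
  rw [hpar x (h.isParam_of_mem_fins hx)]
  exact ht x hx

/-! ### Generic solutions -/

/-- `ρ'` is a solution of the equations of `α` which has the same parameter values as `ρ`, except
that the value of `x` is `t`. -/
structure IsUpdate (α : BasicFormula σ V) (ρ : Valuation σ V) (x : Var σ V) (t : Tree σ x.1)
    (ρ' : Valuation σ V) : Prop where
  satEqs : α.SatEqs ρ'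
  self : ρ' x.1 x.2 = t
  param : ∀ y : Var σ V, α.IsParam y → y ≠ x → ρ' y.1 y.2 = ρ y.1 y.2

theorem IsSolved.exists_isUpdate [IsStrictTotalOrder (Var σ V) lt] (h : α.IsSolved lt)
    (ρ : Valuation σ V) {x : Var σ V} (hx : α.IsParam x) (t : Tree σ x.1) :
    ∃ ρ', α.IsUpdate ρ x t ρ' := by
  classical
  obtain ⟨ρ', hρ', hpar⟩ := h.exists_satEqs
    fun s y => Function.update (fun z : Var σ V => ρ z.1 z.2) x t ⟨s, y⟩
  refine ⟨ρ', hρ', ?_, fun y hy hyx => ?_⟩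
  · exact (hpar x hx).trans (Function.update_self ..)
  · exact (hpar y hy).trans (Function.update_of_ne hyx ..)

theorem IsSolved.eq_of_isUpdate [IsStrictTotalOrder (Var σ V) lt] (h : α.IsSolved lt)
    {ρ ρ₁ ρ₂ : Valuation σ V} {x : Var σ V} {t₁ t₂ : Tree σ x.1} (h₁ : α.IsUpdate ρ x t₁ ρ₁)
    (h₂ : α.IsUpdate ρ x t₂ ρ₂) {s : σ.Srt} {y : V s} (hy : ¬ α.Reachable ⟨s, y⟩ x) :
    ρ₁ s y = ρ₂ s y := by
  refine h.eq_of_satEqs h₁.satEqs h₂.satEqs y fun z hz hpar => ?_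
  have hzx : z ≠ x := by
    rintro rfl
    exact hy hz
  rw [h₁.param z hpar hzx, h₂.param z hpar hzx]

/-- The condition `R` on solutions of `α` can be avoided by the choice of the value of `x`, and
changes of other values can be restricted in such a way that they do not lead back to it. -/
structure Avoidable (α : BasicFormula σ V) (x : Var σ V) (R : Valuation σ V → Prop) : Prop where
  self : ∀ ρ, α.SatEqs ρ → Tree.Thin {t | ∃ ρ', α.IsUpdate ρ x t ρ' ∧ R ρ'}
  other : ∀ ρ, α.SatEqs ρ → ¬ R ρ → ∀ y ≠ x, α.IsParam y →
    Tree.Thin {t | ∃ ρ', α.IsUpdate ρ y t ρ' ∧ R ρ'}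

/-- The condition looks only at the parameter `x`, so an update of another parameter never makes it
true. -/
theorem avoidable_of_thin {x : Var σ V} (hx : α.IsParam x) {P : Set (Tree σ x.1)}
    (hP : Tree.Thin P) : α.Avoidable x fun ρ => ρ x.1 x.2 ∈ P where
  self ρ _ := by
    have hsub : {t | ∃ ρ', α.IsUpdate ρ x t ρ' ∧ ρ' x.1 x.2 ∈ P} ⊆ P := by
      rintro t ⟨ρ', hρ', h⟩
      rwa [hρ'.self] at h
    rcases hP with h | ⟨f, q, hq, h⟩ | ⟨f, hinf, h⟩
    · exact .subsingleton (h.anti hsub)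
    · exact .selfAt f q hq fun t ht => h t (hsub ht)
    · exact .root f hinf fun t ht => h t (hsub ht)
  other ρ _ hR y hyx _ := by
    refine .subsingleton ?_
    rintro t ⟨ρ', hρ', h⟩
    rw [hρ'.param x hx hyx.symm] at h
    exact absurd h hR

/-- Here `α` may make the value of `y` depend on `x`. If it does, the value of `x` is a subtree of
that of `y`, so equality forces a recurrence, at a nonempty position because `y` is smaller than
`x`. If not, the value of `y` leaves only one choice for `x`. When another parameter `w` changes,
`x` stays fixed: either `w` is a subtree of `y`, hence determined by `x`, or `y` is unaffected and
the inequality persists. -/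
theorem IsSolved.avoidable_eq [IsStrictTotalOrder (Var σ V) lt] (h : α.IsSolved lt) {s : σ.Srt}
    {x y : V s} (hx : α.IsParam ⟨s, x⟩) (hlt : lt ⟨s, y⟩ ⟨s, x⟩) :
    α.Avoidable ⟨s, x⟩ fun ρ => ρ s x = ρ s y where
  self ρ _ := by
    by_cases hr : α.Reachable ⟨s, y⟩ ⟨s, x⟩
    · obtain ⟨q, hnil, hroot, hpos⟩ := h.exists_position hr
      have hq : q ≠ [] := by
        intro hq
        rcases hnil hq with heq | hlt'
        · exact irrefl_of lt ⟨s, x⟩ (heq ▸ hlt)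
        · exact asymm_of lt hlt hlt'
      obtain ⟨f, hf⟩ := hroot hq
      refine .selfAt f q hq ?_
      rintro t ⟨ρ', hρ', hxy⟩
      have ht : ρ' s x = t := hρ'.self
      have hy : ρ' s y = t := hxy.symm.trans ht
      have h1 := hf ρ' hρ'.satEqs
      have h2 := hpos ρ' hρ'.satEqs
      simp only [hy, ht] at h1 h2
      exact ⟨h1, h2⟩
    · refine .subsingleton ?_
      rintro t₁ ⟨ρ₁, h₁, he₁⟩ t₂ ⟨ρ₂, h₂, he₂⟩
      rw [← h₁.self, ← h₂.self]
      exact he₁.trans ((h.eq_of_isUpdate h₁ h₂ hr).trans he₂.symm)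
  other ρ hρ hR w hwx hw := by
    refine .subsingleton ?_
    rintro t₁ ⟨ρ₁, h₁, he₁⟩ t₂ ⟨ρ₂, h₂, he₂⟩
    have hx₁ : ρ₁ s x = ρ s x := h₁.param ⟨s, x⟩ hx hwx.symm
    have hx₂ : ρ₂ s x = ρ s x := h₂.param ⟨s, x⟩ hx hwx.symm
    by_cases hr : α.Reachable ⟨s, y⟩ w
    · obtain ⟨q, -, -, hpos⟩ := h.exists_position hr
      refine Tree.ext (funext fun p => ?_)
      rw [← h₁.self, ← h₂.self, ← hpos ρ₁ h₁.satEqs, ← hpos ρ₂ h₂.satEqs]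
      simp only [← he₁, ← he₂, hx₁, hx₂]
    · have h₀ : α.IsUpdate ρ w (ρ w.1 w.2) ρ := ⟨hρ, rfl, fun _ _ _ => rfl⟩
      exact absurd (hx₁.symm.trans (he₁.trans (h.eq_of_isUpdate h₁ h₀ hr))) hR

/-- If the values of finitely many parameters may be chosen from rich sets, then finitely many
conditions avoidable by these choices can be avoided simultaneously. -/
theorem IsSolved.exists_avoiding [IsStrictTotalOrder (Var σ V) lt] (h : α.IsSolved lt)
    (K : ∀ x : Var σ V, Set (Tree σ x.1)) {W : Set (Var σ V)} (hW : W.Finite)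
    (hpar : ∀ x ∈ W, α.IsParam x) (hK : ∀ x ∈ W, Tree.Rich (K x))
    {ρ₀ : Valuation σ V} (hρ₀ : α.SatEqs ρ₀)
    {C : Set (Var σ V × (Valuation σ V → Prop))} (hC : C.Finite)
    (hav : ∀ c ∈ C, α.Avoidable c.1 c.2) :
    ∃ ρ, α.SatEqs ρ ∧ (∀ x ∈ W, ρ x.1 x.2 ∈ K x) ∧
      (∀ x ∉ W, α.IsParam x → ρ x.1 x.2 = ρ₀ x.1 x.2) ∧ ∀ c ∈ C, c.1 ∈ W → ¬ c.2 ρ := by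
  induction W, hW using Set.Finite.induction_on with
  | empty => exact ⟨ρ₀, hρ₀, by simp, by simp, by simp⟩
  | @insert w W hwW _ ih =>
    obtain ⟨ρ, hρ, hρK, hρ₀', hρC⟩ := ih (fun x hx => hpar x (.inr hx)) (fun x hx => hK x (.inr hx))
    have hwpar := hpar w (.inl rfl)
    -- The new value must refute the conditions attached to `w` and preserve the refutation of those
    -- attached to earlier variables; each excludes a thin set.
    obtain ⟨t, htK, ht⟩ := hK w (.inl rfl)
      ((fun c : Var σ V × (Valuation σ V → Prop) => {t | ∃ ρ', α.IsUpdate ρ w t ρ' ∧ c.2 ρ'}) ''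
        {c ∈ C | c.1 ∈ insert w W}) ((hC.subset (Set.sep_subset _ _)).image _) (by
        rintro _ ⟨c, ⟨hcC, hc⟩, rfl⟩
        by_cases hcw : c.1 = w
        · subst hcw
          exact (hav c hcC).self ρ hρ
        · exact (hav c hcC).other ρ hρ (hρC c hcC (hc.resolve_left hcw)) w (Ne.symm hcw) hwpar)
    obtain ⟨ρ', hρ'⟩ := h.exists_isUpdate ρ hwpar t
    refine ⟨ρ', hρ'.satEqs, ?_, ?_, ?_⟩
    · rintro x (rfl | hx)
      · rwa [hρ'.self]
      · rw [hρ'.param x (hpar x (.inr hx)) (by rintro rfl; exact hwW hx)]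
        exact hρK x hx
    · intro x hx hxp
      rw [hρ'.param x hxp (by rintro rfl; exact hx (.inl rfl))]
      exact hρ₀' x (fun h => hx (.inr h)) hxp
    · intro c hcC hc hcR
      exact ht _ ⟨c, ⟨hcC, hc⟩, rfl⟩ ⟨ρ', hρ', hcR⟩

end BasicFormula

/-! ### Free variables of quantified basic formulas -/

theorem Equation.lhsVar_mem_freeVars (e : Equation σ V) : e.lhsVar ∈ e.toFormula.freeVars :=
  .inl rfl

theorem Equation.mem_freeVars_of_mem_vars {e : Equation σ V} {x : Var σ V}
    (hx : x ∈ e.rhs.toTerm.vars) : x ∈ e.toFormula.freeVars :=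
  .inr hx

theorem mem_freeVars_finAtom (x : Var σ V) : x ∈ (finAtom x).freeVars := rfl

theorem BasicFormula.exists_mem_freeVars {α : BasicFormula σ V} {c : Formula σ V}
    (hc : c ∈ α.atoms) : ∃ x, x ∈ c.freeVars := by
  rcases BasicFormula.mem_atoms.mp hc with ⟨e, -, rfl⟩ | ⟨x, -, rfl⟩
  · exact ⟨_, e.lhsVar_mem_freeVars⟩
  · exact ⟨_, mem_freeVars_finAtom x⟩

namespace ExBasic

variable {β : ExBasic σ V}

theorem mem_freeVars {x : Var σ V} :
    x ∈ β.toFormula.freeVars ↔ x ∉ β.bound ∧ ∃ c ∈ β.basic.atoms, x ∈ c.freeVars := by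
  rw [toFormula, Formula.mem_freeVars_exs, BasicFormula.toFormula, Formula.mem_freeVars_conj]

/-- If there are bound variables, then some equation leads from a free to a bound variable. -/
theorem AllReachable.exists_equation (h : β.AllReachable) (hb : β.bound ≠ []) :
    ∃ e ∈ β.basic.eqs, e.lhsVar ∉ β.bound ∧ ∃ y ∈ e.rhs.toTerm.vars, y ∈ β.bound := by
  obtain ⟨x, hx⟩ := List.exists_mem_of_ne_nil _ hb
  obtain ⟨z, hz, hzx⟩ := h x hx
  have hzb := (mem_freeVars.mp hz).1
  clear hz
  induction hzx using Relation.ReflTransGen.head_induction_on with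
  | refl => exact absurd hx hzb
  | @head a b hab _ ih =>
    by_cases hbb : b ∈ β.bound
    · obtain ⟨e, he, rfl, hy⟩ := hab
      exact ⟨e, he, hzb, b, hy, hbb⟩
    · exact ih hbb

end ExBasic

/-! ### Solved normal formulas -/

namespace NormalFormula

variable {N : NormalFormula σ V}

/-- The variable `x` is free in `N` or bound by the outer quantifiers. -/
def Global (N : NormalFormula σ V) (x : Var σ V) : Prop :=
  x ∈ N.toFormula.freeVars ∨ x ∈ N.outer.bound

theorem mem_freeVars {x : Var σ V} :
    x ∈ N.toFormula.freeVars ↔ x ∉ N.outer.bound ∧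
      ((∃ c ∈ N.outer.basic.atoms, x ∈ c.freeVars) ∨ ∃ β ∈ N.inner, x ∈ β.toFormula.freeVars) := by
  rw [toFormula, Formula.freeVars, body, Formula.mem_freeVars_exs, Formula.mem_freeVars_conj]
  simp only [List.mem_append, List.mem_map, or_and_right, exists_or]
  refine and_congr_right fun _ => or_congr_right ?_
  constructor
  · rintro ⟨c, ⟨β, hβ, rfl⟩, hx⟩
    exact ⟨β, hβ, hx⟩
  · rintro ⟨β, hβ, hx⟩
    exact ⟨_, ⟨β, hβ, rfl⟩, hx⟩

theorem global_of_mem_outer {x : Var σ V} {c : Formula σ V} (hc : c ∈ N.outer.basic.atoms)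
    (hx : x ∈ c.freeVars) : N.Global x := by
  by_cases hb : x ∈ N.outer.bound
  · exact .inr hb
  · exact .inl (mem_freeVars.mpr ⟨hb, .inl ⟨c, hc, hx⟩⟩)

theorem global_of_mem_inner {x : Var σ V} {β : ExBasic σ V} (hβ : β ∈ N.inner) {c : Formula σ V}
    (hc : c ∈ β.basic.atoms) (hx : x ∈ c.freeVars) (hxβ : x ∉ β.bound) : N.Global x := by
  by_cases hb : x ∈ N.outer.bound
  · exact .inr hb
  · exact .inl (mem_freeVars.mpr ⟨hb, .inr ⟨β, hβ, ExBasic.mem_freeVars.mpr ⟨hxβ, c, hc, hx⟩⟩⟩)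

theorem VariableConvention.notMem_bound (h : N.VariableConvention) {β : ExBasic σ V}
    (hβ : β ∈ N.inner) {x : Var σ V} (hx : N.Global x) : x ∉ β.bound := by
  intro hxβ
  have hmem : x ∈ N.inner.flatMap ExBasic.bound := List.mem_flatMap.mpr ⟨β, hβ, hxβ⟩
  rcases hx with hx | hx
  · exact h.2 x (List.mem_append_right _ hmem) hx
  · exact (List.nodup_append.mp h.1).2.2 x hx x hmem rfl

theorem IsSolved.outer_bound_eq_nil (hN : N.IsSolved) (h : ∀ e ∈ N.outer.basic.eqs,
    e.lhsVar ∈ N.outer.bound) : N.outer.bound = [] := by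
  by_contra hb
  obtain ⟨e, he, hlhs, -⟩ := hN.outer_reachable.exists_equation hb
  exact hlhs (h e he)

/-- A solved normal formula without free variables is the negation of the empty conjunction. -/
theorem IsSolved.body_eq_verum (hN : N.IsSolved) (hfree : N.toFormula.freeVars = ∅) :
    N.body = .verum := by
  have hglob : ∀ x, N.Global x → x ∈ N.outer.bound := fun x hx =>
    hx.resolve_left (by simp [hfree])
  have hb : N.outer.bound = [] := hN.outer_bound_eq_nil fun e he =>
    hglob _ (global_of_mem_outer (BasicFormula.toFormula_mem_atoms.mpr he) e.lhsVar_mem_freeVars)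
  have hno : ∀ x, ¬ N.Global x := fun x hx => by simpa [hb] using hglob x hx
  have hatoms : N.outer.basic.atoms = [] := by
    refine List.eq_nil_iff_forall_not_mem.mpr fun c hc => ?_
    obtain ⟨x, hx⟩ := BasicFormula.exists_mem_freeVars hc
    exact hno x (global_of_mem_outer hc hx)
  have hinner : N.inner = [] := by
    refine List.eq_nil_iff_forall_not_mem.mpr fun β hβ => ?_
    have hβb : β.bound = [] := by
      by_contra hβb
      obtain ⟨e, he, hlhs, -⟩ := (hN.inner_reachable β hβ).exists_equation hβb
      exact hno _ (global_of_mem_inner hβ (BasicFormula.toFormula_mem_atoms.mpr he)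
        e.lhsVar_mem_freeVars hlhs)
    obtain ⟨c, hc, -⟩ := hN.new_conjunct β hβ
    obtain ⟨x, hx⟩ := BasicFormula.exists_mem_freeVars hc
    exact hno x (global_of_mem_inner hβ hc hx (by simp [hβb]))
  simp [body, hb, hatoms, hinner, Formula.exs, Formula.conj]

/-! ### Falsifying the body -/

theorem exists_tree_ne (hgen : ∀ s : σ.Srt, Nontrivial (σ.Gen s)) {s : σ.Srt} (f : σ.Gen s) :
    ∃ t : Tree σ s, t.label [] ≠ some ⟨s, f⟩ := by
  obtain ⟨g, hg⟩ := exists_ne f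
  refine ⟨.node g fun i => (Tree.nonempty_of_gen (fun s => inferInstance) _).some, ?_⟩
  simpa using hg

/-- If a free variable is constrained by the outer basic formula, then that basic formula
can be falsified by the values of the free variables. -/
theorem IsSolved.exists_not_holds_outer (hgen : ∀ s : σ.Srt, Nontrivial (σ.Gen s))
    (hN : N.IsSolved) (hα : N.outer.basic.atoms ≠ []) :
    ∃ ρ : Valuation σ V, ¬ N.outer.toFormula.Holds ρ := by
  classical
  obtain ⟨lt, hlt, hfo, -, hsα, -⟩ := hN.solved_basic
  have hne : ∀ s, Nonempty (Tree σ s) := Tree.nonempty_of_gen fun s => inferInstance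
  let ρ₀ : Valuation σ V := fun s _ => (hne s).some
  let upd (x : Var σ V) (t : Tree σ x.1) : Valuation σ V :=
    fun s y => Function.update (fun z : Var σ V => ρ₀ z.1 z.2) x t ⟨s, y⟩
  have hself : ∀ x t, upd x t x.1 x.2 = t := fun x t => Function.update_self ..
  have hother : ∀ x t (y : Var σ V), y ≠ x → upd x t y.1 y.2 = ρ₀ y.1 y.2 :=
    fun x t y hy => Function.update_of_ne hy ..
  simp only [ExBasic.toFormula, Formula.holds_exs, BasicFormula.holds_toFormula, not_exists]
  by_cases heq : ∃ e ∈ N.outer.basic.eqs, e.lhsVar ∉ N.outer.bound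
  · obtain ⟨⟨s, x, t⟩, he, hx⟩ := heq
    have hxf : ⟨s, x⟩ ∈ N.toFormula.freeVars := (global_of_mem_outer
      (BasicFormula.toFormula_mem_atoms.mpr he) (Equation.lhsVar_mem_freeVars _)).resolve_right hx
    cases t with
    | var y =>
      have hyx := hsα.ordered s x y he
      -- Being smaller than a free variable, `y` is not bound, so its value can be kept fixed while
      -- the root of `x` is changed.
      have hy : ⟨s, y⟩ ∉ N.outer.bound := fun hy => asymm_of lt hyx (hfo _ hxf _ hy)
      have hne' : (⟨s, y⟩ : Var σ V) ≠ ⟨s, x⟩ := by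
        intro h
        rw [h] at hyx
        exact irrefl_of lt _ hyx
      obtain ⟨f, hf⟩ := (ρ₀ s y).root
      obtain ⟨t, ht⟩ := exists_tree_ne hgen f
      refine ⟨upd ⟨s, x⟩ t, ?_⟩
      rintro ρ' ⟨hρ', hsat, -⟩
      have h1 : ρ' s x = t := (hρ' _ hx).trans (hself _ _)
      have h2 : ρ' s y = ρ₀ s y := (hρ' _ hy).trans (hother _ _ _ hne')
      have h3 : ρ' s x = ρ' s y := hsat _ he
      rw [h1, h2] at h3
      exact ht (h3 ▸ hf)
    | app f z =>
      obtain ⟨t, ht⟩ := exists_tree_ne hgen f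
      refine ⟨upd ⟨s, x⟩ t, ?_⟩
      rintro ρ' ⟨hρ', hsat, -⟩
      have h1 : ρ' s x = t := (hρ' _ hx).trans (hself _ _)
      have h3 : ρ' s x = Tree.node f _ := hsat _ he
      rw [h1] at h3
      exact ht (h3 ▸ rfl)
  · push Not at heq
    -- Nothing is bound now, so there are no equations either and the conjunct must be a finiteness
    -- constraint, broken by an infinite tree.
    have hb := hN.outer_bound_eq_nil heq
    obtain ⟨c, hc⟩ := List.exists_mem_of_ne_nil _ hα
    rcases BasicFormula.mem_atoms.mp hc with ⟨e, he, rfl⟩ | ⟨x, hx, rfl⟩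
    · exact absurd (heq e he) (by simp [hb])
    · obtain ⟨t, ht⟩ := (hsα.fin_sorts x hx).2
      refine ⟨upd x t, ?_⟩
      rintro ρ' ⟨hρ', -, hfin⟩
      have h1 : ρ' x.1 x.2 = t := (hρ' x (by simp [hb])).trans (hself _ _)
      exact ht (h1 ▸ hfin x hx)

/-- If the outer basic formula is empty, then no variable is bound outside and a free variable must
come from some inner formula. That formula is solved, hence satisfiable, and a solution of it
falsifies the body. -/
theorem IsSolved.exists_not_holds_body (hgen : ∀ s : σ.Srt, Nontrivial (σ.Gen s))
    (hN : N.IsSolved) (hfree : N.toFormula.freeVars ≠ ∅) :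
    ∃ ρ : Valuation σ V, ¬ N.body.Holds ρ := by
  by_cases hα : N.outer.basic.atoms = []
  · obtain ⟨lt, hlt, -, -, -, hsβ⟩ := hN.solved_basic
    have heqs : N.outer.basic.eqs = [] := by
      refine List.eq_nil_iff_forall_not_mem.mpr fun e he => ?_
      have := BasicFormula.toFormula_mem_atoms.mpr he
      simp [hα] at this
    have hb := hN.outer_bound_eq_nil (by simp [heqs])
    obtain ⟨x, hx⟩ := Set.nonempty_iff_ne_empty.mpr hfree
    obtain ⟨-, ⟨c, hc, -⟩ | ⟨β, hβ, -⟩⟩ := mem_freeVars.mp hx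
    · simp [hα] at hc
    · obtain ⟨ρ, hρ⟩ := (hsβ β hβ).exists_holds fun s => inferInstance
      refine ⟨ρ, ?_⟩
      rw [body, hb, hα]
      intro h
      exact Formula.holds_conj.mp h (.neg β.toFormula) (by simpa using ⟨β, hβ, rfl⟩)
        (Formula.holds_exs.mpr ⟨ρ, fun _ _ => rfl, hρ⟩)
  · obtain ⟨ρ, hρ⟩ := hN.exists_not_holds_outer hgen hα
    refine ⟨ρ, fun h => hρ ?_⟩
    obtain ⟨ρ', hρ', h'⟩ := Formula.holds_exs.mp h
    refine Formula.holds_exs.mpr ⟨ρ', hρ', Formula.holds_conj.mpr fun c hc => ?_⟩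
    exact Formula.holds_conj.mp h' c (List.mem_append_left _ hc)

/-- Each inner formula can be falsified by the choice of the value of a suitable variable. -/
theorem IsSolved.exists_falsifying {lt : Var σ V → Var σ V → Prop}
    [IsStrictTotalOrder (Var σ V) lt] (hN : N.IsSolved) (hconv : N.VariableConvention)
    (hgβ : ∀ β ∈ N.inner, ∀ x, N.Global x → ∀ y ∈ β.bound, lt x y)
    (hsα : N.outer.basic.IsSolved lt) (hsβ : ∀ β ∈ N.inner, β.basic.IsSolved lt)
    {β : ExBasic σ V} (hβ : β ∈ N.inner) :
    ∃ x, N.Global x ∧ N.outer.basic.IsParam x ∧ N.OccursInStar β x ∧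
      ((x ∉ N.outer.basic.fins ∧ x.1 ∉ σ.SFI ∧ x ∉ β.bound ∧
          ∀ ρ : Valuation σ V, β.basic.toFormula.Holds ρ → (ρ x.1 x.2).IsFinite) ∨
        ∃ R : Valuation σ V → Prop, N.outer.basic.Avoidable x R ∧
          ∀ ρ ρ' : Valuation σ V, (∀ y ∉ β.bound, ρ' y.1 y.2 = ρ y.1 y.2) →
            β.basic.SatEqs ρ' → R ρ) := by
  by_cases hex : ∃ e ∈ β.basic.eqs, e ∉ N.outer.basic.eqs ∧ e.lhsVar ∉ β.bound
  · obtain ⟨⟨s, x, t⟩, he, heα, hx⟩ := hex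
    have hatom := BasicFormula.toFormula_mem_atoms.mpr he
    have hstar : N.StarAtom β (Equation.toFormula ⟨s, x, t⟩) :=
      ⟨hatom, fun h => heα (BasicFormula.toFormula_mem_atoms.mp h)⟩
    have hglob : N.Global ⟨s, x⟩ :=
      global_of_mem_inner hβ hatom (Equation.lhsVar_mem_freeVars _) hx
    -- All equations of `α` are in `β`, where left-hand sides are distinct, so a new equation cannot
    -- define a variable already defined by `α`.
    have hpar : N.outer.basic.IsParam ⟨s, x⟩ := by
      intro e' he' hx'
      have := (hsβ β hβ).eq_of_lhsVar_eq (hN.eqs_included β hβ e' he') he hx'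
      exact heα (this ▸ he')
    refine ⟨⟨s, x⟩, hglob, hpar, ⟨_, hstar, Equation.lhsVar_mem_freeVars _⟩, .inr ?_⟩
    cases t with
    | var y =>
      have hyx := (hsβ β hβ).ordered s x y he
      -- The order keeps `y` from being bound in `β`, so the equation constrains the outer valuation
      -- itself.
      have hy : ⟨s, y⟩ ∉ β.bound := fun hy => asymm_of lt hyx (hgβ β hβ _ hglob _ hy)
      refine ⟨_, hsα.avoidable_eq hpar hyx, fun ρ ρ' hρ' hsat => ?_⟩
      have h1 : ρ' s x = ρ s x := hρ' _ hx
      have h2 : ρ' s y = ρ s y := hρ' _ hy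
      rw [← h1, ← h2]
      exact hsat _ he
    | app f z =>
      have hroot : ∀ ρ ρ' : Valuation σ V, (∀ y ∉ β.bound, ρ' y.1 y.2 = ρ y.1 y.2) →
          β.basic.SatEqs ρ' → (ρ s x).label [] = some ⟨s, f⟩ := by
        intro ρ ρ' hρ' hsat
        have h1 : ρ' s x = ρ s x := hρ' _ hx
        have h2 : ρ' s x = Tree.node f _ := hsat _ he
        rw [← h1, h2]
        rfl
      rcases finite_or_infinite (σ.Gen s) with hfin | hinf
      · have hreach : β.basic.ProperlyReachable ⟨s, x⟩ ⟨s, x⟩ := by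
          by_contra hreach
          exact hN.no_instantiable ⟨s, x⟩ ⟨hglob, .inl ⟨hfin, β, hβ, ⟨f, z, hstar⟩, hreach⟩⟩
        obtain ⟨q, hq, hpos⟩ := BasicFormula.exists_position_of_app (hsβ β hβ) he hreach
        refine ⟨_, BasicFormula.avoidable_of_thin hpar
          (P := {t | t.label [] = some ⟨s, f⟩ ∧ t.SelfAt q}) (.selfAt f q hq fun t ht => ht),
          fun ρ ρ' hρ' hsat => ⟨hroot ρ ρ' hρ' hsat, ?_⟩⟩
        have h1 : ρ' s x = ρ s x := hρ' _ hx
        exact h1 ▸ hpos ρ' hsat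
      · exact ⟨_, BasicFormula.avoidable_of_thin hpar (P := {t | t.label [] = some ⟨s, f⟩})
          (.root f hinf fun t ht => ht), hroot⟩
  · push Not at hex
    -- A bound variable would be reached by an equation with unbound left-hand side. Such equations
    -- now all belong to `α`, which contains no variable bound in `β`.
    have hb : β.bound = [] := by
      by_contra hb
      obtain ⟨e, he, hlhs, y, hy, hyb⟩ := (hN.inner_reachable β hβ).exists_equation hb
      refine hlhs (hex e he fun heα => ?_)
      exact hconv.notMem_bound hβ (global_of_mem_outer (BasicFormula.toFormula_mem_atoms.mpr heα)
        (Equation.mem_freeVars_of_mem_vars hy)) hyb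
    have hfins : ∀ c, N.StarAtom β c → ∃ y, c = finAtom y := by
      rintro c ⟨hc, hcα⟩
      rcases BasicFormula.mem_atoms.mp hc with ⟨e, he, rfl⟩ | ⟨x, -, rfl⟩
      · have := hex e he fun heα => hcα (BasicFormula.toFormula_mem_atoms.mpr heα)
        simp [hb] at this
      · exact ⟨x, rfl⟩
    obtain ⟨c, hc⟩ := hN.new_conjunct β hβ
    obtain ⟨x, rfl⟩ := hfins c hc
    have hxb : x ∉ β.bound := by simp [hb]
    have hglob : N.Global x := global_of_mem_inner hβ hc.1 (mem_freeVars_finAtom x) hxb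
    have hxβ : x ∈ β.basic.fins := BasicFormula.finAtom_mem_atoms.mp hc.1
    refine ⟨x, hglob, fun e he => ?_, ⟨_, hc, mem_freeVars_finAtom x⟩, .inl ⟨?_, ?_, hxb, ?_⟩⟩
    · exact (hsβ β hβ).isParam_of_mem_fins hxβ e (hN.eqs_included β hβ e he)
    · exact fun hx => hc.2 (BasicFormula.finAtom_mem_atoms.mpr hx)
    · exact fun hx => hN.no_instantiable x ⟨hglob, .inr (.inr (.inr ⟨hx, β, hβ, hfins, hc⟩))⟩
    · exact fun ρ hρ => (BasicFormula.holds_toFormula.mp hρ).2 x hxβ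

/-- Only the chosen refuting parameters are changed, starting from a solution of `α`, with values in
sets that respect its finiteness constraints. -/
theorem IsSolved.exists_holds_body (hgen : ∀ s : σ.Srt, Nontrivial (σ.Gen s))
    (hroot : ∀ s : σ.Srt, σ.RootDiverse s) (hN : N.IsSolved) (hconv : N.VariableConvention) :
    ∃ ρ : Valuation σ V, N.body.Holds ρ := by
  classical
  obtain ⟨lt, hlt, -, hgβ, hsα, hsβ⟩ := hN.solved_basic
  have hgen' : ∀ s : σ.Srt, Nonempty (σ.Gen s) := fun s => inferInstance
  obtain ⟨ρ₀, hρ₀⟩ := hsα.exists_holds hgen'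
  rw [BasicFormula.holds_toFormula] at hρ₀
  have hfals := fun β : {β // β ∈ N.inner} => hN.exists_falsifying hconv hgβ hsα hsβ β.2
  choose x hglob hpar hocc hfals using hfals
  -- Infinite trees are preferred, since they refute a new `fin y`; finite ones are used only where
  -- `α` demands them or infinite ones are too few.
  let K (y : Var σ V) : Set (Tree σ y.1) :=
    if y ∈ N.outer.basic.fins ∨ y.1 ∈ σ.SFI then σ.finTrees y.1 else σ.infTrees y.1
  have hfinite : Finite {β // β ∈ N.inner} := N.inner.finite_toSet
  have hK : ∀ β, Tree.Rich (K (x β)) := by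
    intro β
    by_cases hfin : x β ∈ N.outer.basic.fins ∨ (x β).1 ∈ σ.SFI
    · simp only [K, if_pos hfin]
      -- Were finite trees too few as well, the variable would be instantiable by the third or the
      -- second clause.
      refine Tree.rich_finTrees hgen' (hroot _) fun hSFF => hN.no_instantiable (x β) ⟨hglob β, ?_⟩
      rcases hfin with hfin | hSFI
      · exact .inr (.inr (.inl ⟨hSFF, hfin, β, β.2, hocc β⟩))
      · exact .inr (.inl ⟨⟨hSFF, hSFI⟩, ⟨β, β.2, hocc β⟩, hpar β⟩)
    · simp only [K, if_neg hfin]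
      exact Tree.rich_infTrees hgen' (hroot _) fun h => hfin (.inr h)
  have hR : ∀ β, ∃ R : Valuation σ V → Prop, N.outer.basic.Avoidable (x β) R ∧
      ∀ ρ ρ' : Valuation σ V, (∀ y ∉ β.1.bound, ρ' y.1 y.2 = ρ y.1 y.2) →
        ρ (x β).1 (x β).2 ∈ K (x β) → β.1.basic.toFormula.Holds ρ' → R ρ := by
    intro β
    rcases hfals β with ⟨hnfin, hSFI, hxb, hfin⟩ | ⟨R, hav, hR⟩
    -- Here every value in `K` is infinite and already refutes `β`, so the condition to be avoided
    -- can be the empty one.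
    · refine ⟨_, BasicFormula.avoidable_of_thin (hpar β)
        (P := ∅) (.subsingleton Set.subsingleton_empty), fun ρ ρ' hρ' hρK hβ => ?_⟩
      simp only [K, hnfin, hSFI, or_self, if_false] at hρK
      exact hρK (hρ' _ hxb ▸ hfin ρ' hβ)
    · exact ⟨R, hav, fun ρ ρ' hρ' _ hβ => hR ρ ρ' hρ' (BasicFormula.holds_toFormula.mp hβ).1⟩
  choose R hav hR using hR
  obtain ⟨ρ, hρ, hρK, hρ₀', hρR⟩ := hsα.exists_avoiding K (W := Set.range x) (Set.finite_range x)
    (by rintro _ ⟨β, rfl⟩; exact hpar β) (by rintro _ ⟨β, rfl⟩; exact hK β) hρ₀.1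
    (C := Set.range fun β => (x β, R β)) (Set.finite_range _) (by rintro _ ⟨β, rfl⟩; exact hav β)
  refine ⟨ρ, Formula.holds_exs.mpr ⟨ρ, fun _ _ => rfl, Formula.holds_conj.mpr ?_⟩⟩
  rw [List.forall_mem_append, List.forall_mem_map]
  constructor
  · refine Formula.holds_conj.mp (BasicFormula.holds_toFormula.mpr ⟨hρ, fun y hy => ?_⟩)
    by_cases hyW : y ∈ Set.range x
    · have h := hρK y hyW
      simp only [K, hy, true_or, if_true] at h
      exact h
    · rw [hρ₀' y hyW (hsα.isParam_of_mem_fins hy)]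
      exact hρ₀.2 y hy
  · intro β hβ hholds
    obtain ⟨ρ', hρ', h'⟩ := Formula.holds_exs.mp hholds
    exact hρR _ ⟨⟨β, hβ⟩, rfl⟩ ⟨_, rfl⟩ (hR ⟨β, hβ⟩ ρ ρ' hρ' (hρK _ ⟨_, rfl⟩) h')

end NormalFormula

end TreeTheory

theorem mainTheorem2 (σ : TreeTheory.Signature.{u, v}) (V : σ.Srt → Type w)
    (hgen : ∀ s : σ.Srt, Nontrivial (σ.Gen s))
    (hroot : ∀ s : σ.Srt, σ.RootDiverse s)
    (φ : TreeTheory.Formula σ V) (hφ : φ.FullySimplified) :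
    (φ.freeVars = ∅ → φ = .verum ∧ φ.Equivalent .verum) ∧
    (φ.freeVars ≠ ∅ → φ.Satisfiable ∧ (TreeTheory.Formula.neg φ).Satisfiable) := by
  obtain ⟨N, hconv, hN, h⟩ := hφ
  obtain rfl : φ = N.body := by simpa [TreeTheory.NormalFormula.toFormula] using h
  refine ⟨fun hfree => ?_, fun hfree => ?_⟩
  · have hverum := hN.body_eq_verum hfree
    exact ⟨hverum, fun ρ => by rw [hverum]⟩
  · exact ⟨hN.exists_holds_body hgen hroot hconv, hN.exists_not_holds_body hgen hfree⟩
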